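/- Let $n\ge 2$ (the degenerate case $n=1$, where everything about the submatrix is empty, is also allowed). For functions $f_1,\dots,f_n:\mathbb R\to\mathbb R$ we say that $f_1,\dots,f_n$ form a polynomial ensemble with normalization constant $Z_n\in\mathbb R\setminus\{0\}$ if they are linearly independent, the integrals $\int_{-\infty}^{\infty}x^{j-1}f_k(x)\,dx$ $(j,k=1,\dots,n)$ are absolutely convergent, and $$\mathcal P(x_1,\dots,x_n)=\frac1{Z_n}\,\Delta_n(x)\,\det\left[f_k(x_j)\right]_{j,k=1}^n,\qquad \Delta_n(x)=\prod_{j<k}(x_k-x_j),$$ is nonnegative on all of $\mathbb R^n$ and has total integral $1$. The eigenvalues of a random $n\times n$ Hermitian matrix are said to be a polynomial ensemble with functions $f_1,\dots,f_n$ if, for some such $Z_n$, the joint law on $\mathbb R^n$ of its unordered eigenvalues (i.e. of its eigenvalues, with multiplicity, listed in uniformly random order) has density $\mathcal P$ with respect to Lebesgue measure. **Theorem.** Let $X$ be a random $n\times n$ Hermitian matrix whose eigenvalues are a polynomial ensemble with functions $f_1,\dots,f_n$. Let $U$ be a Haar distributed $n\times n$ unitary matrix, independent of $X$, and let $Y$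 be a principal submatrix of $UXU^*$ of size $(n-1)\times(n-1)$ (obtained by deleting the $i$-th row and the $i$-th column, for any fixed $i$). Then the vector space $$V=\Big\{f=\sum_{j=1}^n c_jf_j \;\Big|\; c_1,\dots,c_n\in\mathbb R,\ \int_{-\infty}^{\infty}f(x)\,dx=0\Big\}$$ has dimension $n-1$, and for every basis $\tilde f_1,\dots,\tilde f_{n-1}$ of $V$ the eigenvalues $y_1,\dots,y_{n-1}$ of $Y$ are a polynomial ensemble with functions $$g_k(y)=\int_{-\infty}^{y}\tilde f_k(x)\,dx,\qquad k=1,\dots,n-1,$$ that is, for some constant $\tilde Z_{n-1}\neq0$ their joint density is $$\frac1{\tilde Z_{n-1}}\,\Delta_{n-1}(y)\,\det\left[g_k(y_j)\right]_{j,k=1}^{n-1}.$$ -/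

import Mathlib

open MeasureTheory ProbabilityTheory

namespace PolyEns

/-- Complex matrices carry the product (equivalently, Borel) σ-algebra of their entries. -/
noncomputable instance instMeasurableSpaceMatrix {m n : Type*} :
    MeasurableSpace (Matrix m n ℂ) :=
  inferInstanceAs (MeasurableSpace (m → n → ℂ))

instance instBorelSpaceMatrix {m n : Type*} [Countable m] [Countable n] :
    BorelSpace (Matrix m n ℂ) :=
  inferInstanceAs (BorelSpace (m → n → ℂ))

/-- The Vandermonde product `∏_{j < k} (x_k - x_j)`. -/
def vandermondeProd {n : ℕ} (x : Fin n → ℝ) : ℝ :=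
  ∏ j, ∏ k ∈ Finset.Ioi j, (x k - x j)

/-- The function `(1 / Z) Δ_n(x) det [f_k(x_j)]` on `ℝⁿ`. -/
noncomputable def ensembleDensity {n : ℕ} (f : Fin n → ℝ → ℝ) (Z : ℝ) (x : Fin n → ℝ) : ℝ :=
  1 / Z * vandermondeProd x * (Matrix.of fun j k => f k (x j)).det

/-- `(1 / Z) Δ_n(x) det [f_k(x_j)]` is a polynomial ensemble: the functions `f_k` are linearly
independent and have convergent moments of the orders `0, …, n - 1`, and the function is a
probability density on `ℝⁿ` (nonnegative everywhere, with total integral one). -/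
structure IsPolynomialEnsemble {n : ℕ} (f : Fin n → ℝ → ℝ) (Z : ℝ) : Prop where
  linearIndependent : LinearIndependent ℝ f
  moments : ∀ j k : Fin n, Integrable (fun x : ℝ => x ^ (j : ℕ) * f k x)
  norm_ne_zero : Z ≠ 0
  nonneg : ∀ x : Fin n → ℝ, 0 ≤ ensembleDensity f Z x
  lintegral_eq_one : ∫⁻ x : Fin n → ℝ, ENNReal.ofReal (ensembleDensity f Z x) = 1

/-- The law on `ℝⁿ` of the unordered eigenvalues (with multiplicity) of a random Hermitian
matrix `A`, that is, of its eigenvalues listed in a uniformly random order. -/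
noncomputable def unorderedEigenvalueLaw {Ω : Type*} [MeasurableSpace Ω] (μ : Measure Ω) {n : ℕ}
    (A : Ω → Matrix (Fin n) (Fin n) ℂ) (hA : ∀ ω, (A ω).IsHermitian) : Measure (Fin n → ℝ) :=
  (n.factorial : ENNReal)⁻¹ •
    ∑ σ : Equiv.Perm (Fin n), μ.map (fun ω i => (hA ω).eigenvalues (σ i))

/-- The eigenvalues of the random Hermitian matrix `A` are a polynomial ensemble with functions
`f_1, …, f_n`: for some normalization constant `Z`, the joint density of the unordered eigenvalues
is `(1 / Z) Δ_n(x) det [f_k(x_j)]`. -/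
def EigenvaluesArePolynomialEnsemble {Ω : Type*} [MeasurableSpace Ω] (μ : Measure Ω) {n : ℕ}
    (A : Ω → Matrix (Fin n) (Fin n) ℂ) (hA : ∀ ω, (A ω).IsHermitian) (f : Fin n → ℝ → ℝ) : Prop :=
  ∃ Z : ℝ, IsPolynomialEnsemble f Z ∧
    unorderedEigenvalueLaw μ A hA =
      (volume : Measure (Fin n → ℝ)).withDensity fun x => ENNReal.ofReal (ensembleDensity f Z x)

/-- `U` is a Haar distributed random unitary matrix: its law is a Haar measure on the unitary
group (the normalized one when `μ` is a probability measure). -/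
def IsHaarUnitary {Ω : Type*} [MeasurableSpace Ω] (μ : Measure Ω) {n : ℕ}
    (U : Ω → Matrix.unitaryGroup (Fin n) ℂ) : Prop :=
  Measurable U ∧ (μ.map U).IsHaarMeasure

/-- The `n × n` principal submatrix of `U X U*` obtained by deleting row and column `i`. -/
def restriction {n : ℕ} (i : Fin (n + 1)) (X : Matrix (Fin (n + 1)) (Fin (n + 1)) ℂ)
    (U : Matrix.unitaryGroup (Fin (n + 1)) ℂ) : Matrix (Fin n) (Fin n) ℂ :=
  ((U : Matrix (Fin (n + 1)) (Fin (n + 1)) ℂ) * X *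
    (U : Matrix (Fin (n + 1)) (Fin (n + 1)) ℂ).conjTranspose).submatrix i.succAbove i.succAbove

theorem isHermitian_restriction {n : ℕ} (i : Fin (n + 1))
    {X : Matrix (Fin (n + 1)) (Fin (n + 1)) ℂ} (hX : X.IsHermitian)
    (U : Matrix.unitaryGroup (Fin (n + 1)) ℂ) : (restriction i X U).IsHermitian :=
  (Matrix.isHermitian_mul_mul_conjTranspose _ hX).submatrix _

/-- The vector space of (integrable) linear combinations `h` of the functions `f_j` with
`∫ h = 0`. Every linear combination is integrable as soon as the `f_j` are. -/
noncomputable def zeroIntegralSpan {m : ℕ} (f : Fin m → ℝ → ℝ) : Submodule ℝ (ℝ → ℝ) where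
  carrier := {h | h ∈ Submodule.span ℝ (Set.range f) ∧ Integrable h ∧ ∫ x, h x = 0}
  add_mem' := by
    rintro a b ⟨ha, ia, za⟩ ⟨hb, ib, zb⟩
    refine ⟨add_mem ha hb, ia.add ib, ?_⟩
    have := integral_add ia ib
    simp only [Pi.add_apply]
    rw [this, za, zb, add_zero]
  zero_mem' := ⟨zero_mem _, integrable_zero _ _ _, by simp⟩
  smul_mem' := by
    rintro c a ⟨ha, ia, za⟩
    refine ⟨Submodule.smul_mem _ c ha, ia.smul c, ?_⟩
    simp only [Pi.smul_apply, smul_eq_mul]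
    rw [integral_const_mul, za, mul_zero]

end PolyEns

/-!
Let `x` be the increasing spectrum of `X`. By the spectral theorem and the invariance of Haar
measure, the spectrum `y` of the compression of `U X U*` is distributed, given `X`, as the zero set
of `∑_k w_k ∏_{l ≠ k} (t - x_l)`, where `w_k = |U_{ik}|²`
(`sortedEigenvalues_restriction`, `lintegral_sortedEigenvalues_restriction`): this polynomial is the
`i`-th diagonal entry of the adjugate of `t - U diag(x) U*`.

A row of a Haar unitary matrix is uniform on the sphere, so up to scaling `w` is uniform on
`{w | 0 < w_k, ∑ w_k ≤ 1}` (`lintegral_haar_row`). The zeros strictly interlace `x`, and the map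
from the total weight and the interlacing vector `y` to `w` has Jacobian determinant
`s ^ n Δ(y) / Δ(x)`, a Cauchy determinant (`abs_det_weightsJacobian`). Hence `y` has conditional
density proportional to `Δ(y) / Δ(x)` on the vectors interlacing `x`
(`lintegral_haar_secularRoots`).

Multiplying by the density `(1 / Z) Δ(x) det [f_k(x_j)]` of `x` cancels `Δ(x)`. For fixed `y` the
vectors `x` interlaced by `y` form a box, over which the determinant integrates to the determinant
of the integrals of the `f_k` over consecutive intervals, and cumulative row sums turn these into
`∫_{-∞}^{y_j} f_k`, with a last row `∫ f_k` (`lintegral_chamber_interlacing`). Since the total mass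
is one, some `∫ f_k` is nonzero, and a change of basis to functions of zero integral reduces the
determinant to `det [g_k(y_j)]` (`exists_det_cumulativeMatrix_eq`). All constants that do not depend
on `x` and `y` are fixed at the end by the total mass
(`eigenvaluesArePolynomialEnsemble_of_sorted`).

Eigenvalues are handled in increasing order. They are a measurable function of the matrix because,
by the Lusin–Souslin theorem, the map from ordered roots to polynomials is a measurable embedding.
-/

namespace PolyEns

/-! ### Sorted roots and sorted eigenvalues -/


/-- The values at `0, 1, 2, …` of the polynomial with positive leading coefficient `p.2` and
(weakly increasing) root vector `p.1`. -/
def polyValues {n : ℕ} (p : {y : Fin n → ℝ // Monotone y} × Set.Ioi (0 : ℝ)) : ℕ → ℝ :=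
  fun j => (p.2 : ℝ) * ∏ i, ((j : ℝ) - p.1.1 i)

theorem monotone_eq_of_map_eq {n : ℕ} {y z : Fin n → ℝ} (hy : Monotone y) (hz : Monotone z)
    (h : Multiset.map y Finset.univ.val = Multiset.map z Finset.univ.val) : y = z := by
  have h1 : List.ofFn y = List.ofFn z := by
    apply List.Perm.eq_of_sortedLE
    · exact hy.sortedLE_ofFn
    · exact hz.sortedLE_ofFn
    · rw [Fin.univ_val_map, Fin.univ_val_map] at h
      exact Multiset.coe_eq_coe.mp h
  exact List.ofFn_injective h1

theorem eq_of_forall_nat_eval_eq {p q : Polynomial ℝ}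
    (h : ∀ j : ℕ, p.eval (j : ℝ) = q.eval (j : ℝ)) : p = q := by
  apply Polynomial.eq_of_infinite_eval_eq
  apply (Set.infinite_range_of_injective (Nat.cast_injective (R := ℝ))).mono
  rintro _ ⟨j, rfl⟩
  exact h j

theorem polyValues_injective {n : ℕ} : Function.Injective (polyValues (n := n)) := by
  rintro ⟨⟨y, hy⟩, ⟨s, hs⟩⟩ ⟨⟨z, hz⟩, ⟨t, ht⟩⟩ h
  have hs' : s ≠ 0 := ne_of_gt hs
  have ht' : t ≠ 0 := ne_of_gt ht
  have key : Polynomial.C s * ∏ i, (Polynomial.X - Polynomial.C (y i))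
      = Polynomial.C t * ∏ i, (Polynomial.X - Polynomial.C (z i)) := by
    apply eq_of_forall_nat_eval_eq
    intro j
    have := congrFun h j
    simpa [polyValues, Polynomial.eval_prod] using this
  have hst : s = t := by
    have := congrArg Polynomial.leadingCoeff key
    simpa [Polynomial.leadingCoeff_mul, Polynomial.leadingCoeff_prod] using this
  have hyz : y = z := by
    apply monotone_eq_of_map_eq hy hz
    have := congrArg Polynomial.roots key
    rw [Polynomial.roots_C_mul _ hs', Polynomial.roots_C_mul _ ht',
      Polynomial.roots_prod _ _ (Finset.prod_ne_zero_iff.mpr fun i _ => Polynomial.X_sub_C_ne_zero _),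
      Polynomial.roots_prod _ _ (Finset.prod_ne_zero_iff.mpr fun i _ => Polynomial.X_sub_C_ne_zero _)]
      at this
    simpa using this
  subst hst hyz
  rfl

theorem isClosed_setOf_monotone (n : ℕ) : IsClosed {y : Fin n → ℝ | Monotone y} := by
  have : {y : Fin n → ℝ | Monotone y} = ⋂ (i) (j) (_ : i ≤ j), {y | y i ≤ y j} := by
    ext y; simp [Monotone]
  rw [this]
  exact isClosed_iInter fun i => isClosed_iInter fun j => isClosed_iInter fun _ =>
    isClosed_le (continuous_apply i) (continuous_apply j)

/-- A continuous injection between standard Borel spaces is a measurable embedding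
(Lusin–Souslin); this is what makes the passage from a polynomial to its roots measurable. -/
theorem measurableEmbedding_polyValues (n : ℕ) : MeasurableEmbedding (polyValues (n := n)) := by
  have : PolishSpace {y : Fin n → ℝ // Monotone y} := (isClosed_setOf_monotone n).polishSpace
  have : PolishSpace (Set.Ioi (0 : ℝ)) := isOpen_Ioi.polishSpace
  refine Continuous.measurableEmbedding ?_ polyValues_injective
  refine continuous_pi fun j => ?_
  refine (continuous_subtype_val.comp continuous_snd).mul (continuous_finsetProd _ fun i _ => ?_)
  exact continuous_const.sub
    ((continuous_apply i).comp (continuous_subtype_val.comp continuous_fst))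

theorem exists_sortedRoots (n : ℕ) : ∃ R : (ℕ → ℝ) → (Fin n → ℝ), Measurable R ∧
    R ∘ polyValues = fun p => p.1.1 :=
  (measurableEmbedding_polyValues n).exists_measurable_extend
    (measurable_subtype_coe.comp measurable_fst) fun _ => inferInstance

/-- The increasing vector of roots of a real-rooted polynomial of degree `n` with positive leading
coefficient, as a function of its values at `0, 1, 2, …`. -/
noncomputable def sortedRoots (n : ℕ) : (ℕ → ℝ) → (Fin n → ℝ) :=
  Classical.choose (exists_sortedRoots n)

@[fun_prop]
theorem measurable_sortedRoots (n : ℕ) : Measurable (sortedRoots n) :=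
  (Classical.choose_spec (exists_sortedRoots n)).1

theorem sortedRoots_eq {n : ℕ} {y : Fin n → ℝ} (hy : Monotone y) {s : ℝ} (hs : 0 < s) :
    sortedRoots n (fun j => s * ∏ i, ((j : ℝ) - y i)) = y :=
  congrFun (Classical.choose_spec (exists_sortedRoots n)).2 (⟨y, hy⟩, ⟨s, hs⟩)

/-- The eigenvalues of a Hermitian matrix in increasing order, as a measurable function on all
matrices (with an irrelevant value at matrices that are not Hermitian). -/
noncomputable def sortedEigenvalues {n : ℕ} (A : Matrix (Fin n) (Fin n) ℂ) : Fin n → ℝ :=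
  sortedRoots n fun j => ((j : ℂ) • (1 : Matrix (Fin n) (Fin n) ℂ) - A).det.re

theorem measurable_matrix_apply {m n : Type*} (i : m) (j : n) :
    Measurable fun A : Matrix m n ℂ => A i j :=
  (measurable_pi_apply j).comp (measurable_pi_apply (X := fun _ : m => n → ℂ) i)

@[fun_prop]
theorem measurable_sortedEigenvalues (n : ℕ) : Measurable (sortedEigenvalues (n := n)) := by
  refine (measurable_sortedRoots n).comp (measurable_pi_iff.mpr fun j => ?_)
  have : Continuous fun A : Matrix (Fin n) (Fin n) ℂ =>
      ((j : ℂ) • (1 : Matrix (Fin n) (Fin n) ℂ) - A).det.re := by fun_prop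
  exact this.measurable

theorem sortedEigenvalues_eq {n : ℕ} {A : Matrix (Fin n) (Fin n) ℂ} {y : Fin n → ℝ}
    (hy : Monotone y)
    (h : ∀ j : ℕ, ((j : ℂ) • (1 : Matrix (Fin n) (Fin n) ℂ) - A).det.re = ∏ i, ((j : ℝ) - y i)) :
    sortedEigenvalues A = y := by
  have := sortedRoots_eq hy one_pos
  simp only [one_mul] at this
  rw [← this, sortedEigenvalues]
  congr 1
  funext j
  exact h j

theorem det_smul_one_sub_eq_prod_eigenvalues {n : ℕ} {A : Matrix (Fin n) (Fin n) ℂ}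
    (hA : A.IsHermitian) (t : ℝ) :
    ((t : ℂ) • (1 : Matrix (Fin n) (Fin n) ℂ) - A).det = ∏ i, ((t : ℂ) - hA.eigenvalues i) := by
  have h := congrArg (Polynomial.eval (t : ℂ)) hA.charpoly_eq
  rw [Matrix.eval_charpoly, Polynomial.eval_prod] at h
  simpa [Matrix.smul_one_eq_diagonal, Matrix.scalar_apply] using h

/-- Mathlib's `eigenvalues` is decreasing up to a reindexing that does not depend on the matrix. -/
theorem exists_perm_eigenvalues (n : ℕ) : ∃ ρ : Equiv.Perm (Fin n),
    ∀ (A : Matrix (Fin n) (Fin n) ℂ) (hA : A.IsHermitian),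
      Monotone (hA.eigenvalues ∘ ρ) ∧ sortedEigenvalues A = hA.eigenvalues ∘ ρ := by
  let e : Fin (Fintype.card (Fin n)) ≃ Fin n := Fintype.equivOfCardEq (Fintype.card_fin _)
  let c : Fin n ≃ Fin (Fintype.card (Fin n)) := finCongr (Fintype.card_fin n).symm
  refine ⟨(Fin.revPerm.trans c).trans e, fun A hA => ?_⟩
  have hm : Monotone (hA.eigenvalues ∘ ((Fin.revPerm.trans c).trans e)) := by
    intro i j hij
    have : ∀ k, hA.eigenvalues (((Fin.revPerm.trans c).trans e) k) = hA.eigenvalues₀ (c k.rev) := by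
      intro k
      simp [Matrix.IsHermitian.eigenvalues, e]
    simp only [Function.comp_apply, this]
    apply hA.eigenvalues₀_antitone
    simpa [c, Fin.le_def] using Fin.rev_le_rev.mpr hij
  refine ⟨hm, sortedEigenvalues_eq hm fun j => ?_⟩
  have := det_smul_one_sub_eq_prod_eigenvalues hA (j : ℝ)
  simp only [Complex.ofReal_natCast] at this
  rw [this, Function.comp_def, Equiv.prod_comp ((Fin.revPerm.trans c).trans e)
    (fun i => (j : ℝ) - hA.eigenvalues i)]
  rw [← Complex.ofReal_re (∏ i, ((j : ℝ) - hA.eigenvalues i))]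
  push_cast
  rfl

theorem monotone_sortedEigenvalues {n : ℕ} {A : Matrix (Fin n) (Fin n) ℂ} (hA : A.IsHermitian) :
    Monotone (sortedEigenvalues A) := by
  obtain ⟨ρ, hρ⟩ := exists_perm_eigenvalues n
  rw [(hρ A hA).2]
  exact (hρ A hA).1

/-! ### Spectra of compressions -/


theorem prod_erase_eq_prod_succAbove {M : Type*} [CommMonoid M] {n : ℕ} (k : Fin (n + 1))
    (v : Fin (n + 1) → M) : ∏ j ∈ Finset.univ.erase k, v j = ∏ l, v (k.succAbove l) := by
  rw [← Finset.prod_image (s := Finset.univ) (f := v)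
    (Fin.succAbove_right_injective (p := k)).injOn]
  congr 1
  rw [Fin.image_succAbove_univ, Finset.compl_eq_univ_sdiff, Finset.sdiff_singleton_eq_erase]

open Matrix in
theorem adjugate_of_mem_unitaryGroup {m : Type*} [Fintype m] [DecidableEq m]
    {W : Matrix m m ℂ} (hW : W ∈ unitaryGroup m ℂ) : W.adjugate = W.det • Wᴴ := by
  have h1 : W * Wᴴ = 1 := mem_unitaryGroup_iff.mp hW
  calc W.adjugate = W.adjugate * (W * Wᴴ) := by rw [h1, mul_one]
    _ = W.det • Wᴴ := by rw [← mul_assoc, adjugate_mul, smul_mul, one_mul]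

open Matrix in
theorem adjugate_conj_of_mem_unitaryGroup {m : Type*} [Fintype m] [DecidableEq m]
    {W : Matrix m m ℂ} (hW : W ∈ unitaryGroup m ℂ) (D : Matrix m m ℂ) :
    (W * D * Wᴴ).adjugate = W * D.adjugate * Wᴴ := by
  have h1 : W * Wᴴ = 1 := mem_unitaryGroup_iff.mp hW
  have hW' : Wᴴ ∈ unitaryGroup m ℂ := by
    rw [← star_eq_conjTranspose]; exact Unitary.star_mem hW
  rw [adjugate_mul_distrib, adjugate_mul_distrib, adjugate_of_mem_unitaryGroup hW,
    adjugate_of_mem_unitaryGroup hW', conjTranspose_conjTranspose, Matrix.mul_smul, Matrix.smul_mul,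
    Matrix.mul_smul, smul_smul, ← det_mul, mul_eq_one_comm.mp h1, det_one, one_smul, mul_assoc]

open Matrix in
/-- The characteristic polynomial of the compression of `diag(d)` by a unitary matrix `W` depends
on `W` only through the squared moduli of the entries of its `i`-th row: the determinant of the
compression of the resolvent is a diagonal entry of an adjugate matrix. -/
theorem det_smul_one_sub_restriction {n : ℕ} (i : Fin (n + 1)) (d : Fin (n + 1) → ℝ)
    (W : unitaryGroup (Fin (n + 1)) ℂ) (t : ℝ) :
    ((t : ℂ) • (1 : Matrix (Fin n) (Fin n) ℂ)
      - restriction i (diagonal fun k => (d k : ℂ)) W).det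
      = ((∑ k, Complex.normSq (W.1 i k) * ∏ l, (t - d (k.succAbove l)) : ℝ) : ℂ) := by
  set M : Matrix (Fin (n + 1)) (Fin (n + 1)) ℂ := W.1 with hM
  have h1 : M * Mᴴ = 1 := mem_unitaryGroup_iff.mp W.2
  have h2 : (t : ℂ) • (1 : Matrix (Fin n) (Fin n) ℂ)
      - restriction i (diagonal fun k => (d k : ℂ)) W
      = (M * diagonal (fun k => (t : ℂ) - d k) * Mᴴ).submatrix i.succAbove i.succAbove := by
    have h3 : diagonal (fun k => (t : ℂ) - d k)
        = (t : ℂ) • (1 : Matrix (Fin (n + 1)) (Fin (n + 1)) ℂ) - diagonal fun k => (d k : ℂ) := by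
      rw [smul_one_eq_diagonal, diagonal_sub]
    rw [h3, mul_sub, sub_mul, Matrix.mul_smul, mul_one, Matrix.smul_mul, h1]
    ext a b
    simp [restriction, Matrix.one_apply, hM]
  rw [h2]
  have h4 := adjugate_fin_succ_eq_det_submatrix (M * diagonal (fun k => (t : ℂ) - d k) * Mᴴ) i i
  rw [Even.neg_one_pow ⟨_, rfl⟩, one_mul] at h4
  rw [← h4, hM, adjugate_conj_of_mem_unitaryGroup W.2, adjugate_diagonal, ← hM]
  rw [Matrix.mul_apply]
  push_cast
  refine Finset.sum_congr rfl fun k _ => ?_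
  rw [mul_diagonal, prod_erase_eq_prod_succAbove, conjTranspose_apply, mul_right_comm,
    ← Complex.mul_conj]
  rfl

/-- The increasing vector of zeros of `∑_k w_k ∏_{l ≠ k} (t - d_l)`. -/
noncomputable def secularRoots {n : ℕ} (d w : Fin (n + 1) → ℝ) : Fin n → ℝ :=
  sortedRoots n fun j => ∑ k, w k * ∏ l, ((j : ℝ) - d (k.succAbove l))

theorem measurable_secularRoots {n : ℕ} :
    Measurable fun p : (Fin (n + 1) → ℝ) × (Fin (n + 1) → ℝ) => secularRoots p.1 p.2 := by
  unfold secularRoots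
  fun_prop

theorem sortedEigenvalues_restriction_diagonal {n : ℕ} (i : Fin (n + 1)) (d : Fin (n + 1) → ℝ)
    (W : Matrix.unitaryGroup (Fin (n + 1)) ℂ) :
    sortedEigenvalues (restriction i (Matrix.diagonal fun k => (d k : ℂ)) W)
      = secularRoots d fun k => Complex.normSq (W.1 i k) := by
  unfold sortedEigenvalues secularRoots
  congr 1
  funext j
  have := det_smul_one_sub_restriction i d W (j : ℝ)
  rw [Complex.ofReal_natCast] at this
  rw [this, Complex.ofReal_re]

open Matrix in
theorem restriction_conj {n : ℕ} (i : Fin (n + 1)) (D : Matrix (Fin (n + 1)) (Fin (n + 1)) ℂ)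
    (U V : unitaryGroup (Fin (n + 1)) ℂ) :
    restriction i (V.1 * D * V.1ᴴ) U = restriction i D (U * V) := by
  simp [restriction, mul_assoc, conjTranspose_mul]

open Matrix in
/-- The spectral theorem with the eigenvalues in increasing order. -/
theorem exists_unitary_conj_sortedEigenvalues {n : ℕ} {A : Matrix (Fin n) (Fin n) ℂ}
    (hA : A.IsHermitian) : ∃ V : unitaryGroup (Fin n) ℂ,
      A = V.1 * diagonal (fun k => (sortedEigenvalues A k : ℂ))
        * V.1ᴴ := by
  obtain ⟨ρ, hρ⟩ := exists_perm_eigenvalues n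
  have hs := hA.spectral_theorem
  rw [Unitary.conjStarAlgAut_apply] at hs
  set W : Matrix (Fin n) (Fin n) ℂ := hA.eigenvectorUnitary.1 with hW
  have hW1 : W * Wᴴ = 1 := mem_unitaryGroup_iff.mp hA.eigenvectorUnitary.2
  have hsub (D : Fin n → ℂ) : W.submatrix id ρ * diagonal (D ∘ ρ) * (W.submatrix id ρ)ᴴ
      = W * diagonal D * Wᴴ := by
    ext a b
    rw [Matrix.mul_apply, Matrix.mul_apply, ← Equiv.sum_comp ρ fun k =>
      (W * diagonal D) a k * Wᴴ k b]
    simp [mul_diagonal]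
  have hV : W.submatrix id ρ ∈ unitaryGroup (Fin n) ℂ := by
    rw [mem_unitaryGroup_iff, star_eq_conjTranspose]
    simpa only [Function.comp_def, diagonal_one, mul_one, hW1] using hsub fun _ => 1
  refine ⟨⟨_, hV⟩, ?_⟩
  rw [(hρ A hA).2]
  exact hs.trans (hsub fun k => (hA.eigenvalues k : ℂ)).symm

/-- The law of the spectrum of the compression of `A` by a Haar unitary depends only on the
spectrum of `A`. -/
theorem sortedEigenvalues_restriction {n : ℕ} (i : Fin (n + 1))
    {A : Matrix (Fin (n + 1)) (Fin (n + 1)) ℂ} (hA : A.IsHermitian) :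
    ∃ V : Matrix.unitaryGroup (Fin (n + 1)) ℂ, ∀ U : Matrix.unitaryGroup (Fin (n + 1)) ℂ,
      sortedEigenvalues (restriction i A U) = secularRoots (sortedEigenvalues A)
        fun k => Complex.normSq ((U * V).1 i k) := by
  obtain ⟨V, hV⟩ := exists_unitary_conj_sortedEigenvalues hA
  refine ⟨V, fun U => ?_⟩
  conv_lhs => rw [hV, restriction_conj]
  exact sortedEigenvalues_restriction_diagonal i _ _

/-! ### Rows of Haar unitary matrices -/


/-- A left invariant probability measure on a group is right invariant: by Fubini's theorem it
agrees with its image under inversion. -/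
theorem lintegral_mul_right_eq_self_of_isProbabilityMeasure {G : Type*} [Group G]
    [MeasurableSpace G] [MeasurableMul₂ G] [MeasurableInv G] (μ : Measure G)
    [IsProbabilityMeasure μ] [μ.IsMulLeftInvariant] {F : G → ENNReal} (hF : Measurable F) (g : G) :
    ∫⁻ u, F (u * g) ∂μ = ∫⁻ u, F u ∂μ := by
  have : IsProbabilityMeasure μ.inv := by
    rw [Measure.inv]; exact Measure.isProbabilityMeasure_map measurable_inv.aemeasurable
  have key : ∀ F : G → ENNReal, Measurable F → ∫⁻ u, F u ∂μ = ∫⁻ u, F u ∂μ.inv := by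
    intro F hF
    calc ∫⁻ u, F u ∂μ = ∫⁻ x, ∫⁻ y, F (x * y) ∂μ ∂μ.inv := by
          simp [lintegral_mul_left_eq_self]
      _ = ∫⁻ y, ∫⁻ x, F (x * y) ∂μ.inv ∂μ :=
          lintegral_lintegral_swap (hF.comp measurable_mul).aemeasurable
      _ = ∫⁻ u, F u ∂μ.inv := by
          simp [lintegral_mul_right_eq_self]
  have hg := key _ (hF.comp (measurable_mul_const g))
  simp only [Function.comp_apply] at hg
  rw [hg, key _ hF]
  exact lintegral_mul_right_eq_self F g

open Matrix in
/-- The unitary group acts transitively on the unit sphere: every nonzero vector is a positive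
multiple of the `i`-th row of a unitary matrix. -/
theorem exists_unitary_row {N : ℕ} (i : Fin N) {g : Fin N → ℂ} (hg : g ≠ 0) :
    ∃ (v : unitaryGroup (Fin N) ℂ) (r : ℝ), 0 < r ∧ g = (r : ℂ) • v.1 i := by
  set G : EuclideanSpace ℂ (Fin N) := WithLp.toLp 2 g with hG
  have hG0 : G ≠ 0 := by
    intro h
    apply hg
    have := congrArg WithLp.ofLp h
    simpa [hG] using this
  have hr : 0 < ‖G‖ := norm_pos_iff.mpr hG0
  set e : EuclideanSpace ℂ (Fin N) := ((‖G‖⁻¹ : ℝ) : ℂ) • G with he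
  have hnorm : ‖e‖ = 1 := by
    rw [he, norm_smul, Complex.norm_real, norm_inv, norm_norm, inv_mul_cancel₀ hr.ne']
  obtain ⟨b, hb⟩ := Orthonormal.exists_orthonormalBasis_extension_of_card_eq (𝕜 := ℂ)
    (E := EuclideanSpace ℂ (Fin N)) (ι := Fin N) (by simp) (v := fun _ => e) (s := {i}) (by
      rw [orthonormal_iff_ite]
      rintro ⟨a, rfl⟩ ⟨a', rfl⟩
      simp [hnorm, Set.domRestrict])
  refine ⟨⟨Matrix.of fun a k => b a k, ?_⟩, ‖G‖, hr, ?_⟩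
  · rw [mem_unitaryGroup_iff, star_eq_conjTranspose]
    ext a c
    have := orthonormal_iff_ite.mp b.orthonormal c a
    rw [PiLp.inner_apply] at this
    rw [Matrix.mul_apply, Matrix.one_apply]
    simp only [eq_comm (a := a), ← this]
    refine Finset.sum_congr rfl fun k _ => ?_
    simp [conjTranspose_apply]
  · have h1 : b i = e := hb i rfl
    funext k
    have h2 : b i k = e k := by rw [h1]
    simp only [Pi.smul_apply, Matrix.of_apply, h2, he, PiLp.smul_apply, smul_eq_mul]
    rw [← mul_assoc, ← Complex.ofReal_mul, mul_inv_cancel₀ hr.ne', Complex.ofReal_one, one_mul]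

/-- By left invariance and transitivity, a scale invariant function has the same mean along the
Haar orbit of every nonzero vector. -/
theorem lintegral_haar_vecMul {N : ℕ} (H : Measure (Matrix.unitaryGroup (Fin N) ℂ))
    [H.IsMulLeftInvariant] {Φ : (Fin N → ℂ) → ENNReal}
    (hs : ∀ (r : ℝ) (g : Fin N → ℂ), 0 < r → Φ ((r : ℂ) • g) = Φ g) (i : Fin N)
    {g : Fin N → ℂ} (hg : g ≠ 0) :
    ∫⁻ u, Φ (Matrix.vecMul g u.1) ∂H = ∫⁻ u, Φ (u.1 i) ∂H := by
  obtain ⟨v, r, hr, rfl⟩ := exists_unitary_row i hg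
  have h1 : ∀ u : Matrix.unitaryGroup (Fin N) ℂ,
      Φ (Matrix.vecMul ((r : ℂ) • v.1 i) u.1) = Φ ((v * u).1 i) := by
    intro u
    rw [Matrix.smul_vecMul, hs r _ hr]
    congr 1
  simp only [h1]
  exact lintegral_mul_left_eq_self (fun u : Matrix.unitaryGroup (Fin N) ℂ => Φ (u.1 i)) v

theorem sum_normSq_vecMul {N : ℕ} (u : Matrix.unitaryGroup (Fin N) ℂ) (g : Fin N → ℂ) :
    ∑ k, Complex.normSq (Matrix.vecMul g u.1 k) = ∑ k, Complex.normSq (g k) := by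
  have h1 : u.1 * u.1.conjTranspose = 1 := Matrix.mem_unitaryGroup_iff.mp u.2
  have h2 : ∀ g : Fin N → ℂ, ((∑ k, Complex.normSq (g k) : ℝ) : ℂ) = g ⬝ᵥ star g := by
    intro g
    simp [dotProduct, Complex.mul_conj]
  have h3 : ((∑ k, Complex.normSq (Matrix.vecMul g u.1 k) : ℝ) : ℂ)
      = ((∑ k, Complex.normSq (g k) : ℝ) : ℂ) := by
    rw [h2, h2, Matrix.star_vecMul, Matrix.dotProduct_mulVec, Matrix.vecMul_vecMul, h1,
      Matrix.vecMul_one]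
  exact_mod_cast h3

/-- The closed Euclidean ball `π ∑ |g_k|² ≤ 1` in `ℂᴺ`. The factor `π` makes `π |z|²` carry Lebesgue
measure on `ℂ` to Lebesgue measure on the half-line. -/
def unitaryBall (N : ℕ) : Set (Fin N → ℂ) :=
  {g | ∑ k, Real.pi * Complex.normSq (g k) ≤ 1}

theorem measurableSet_unitaryBall (N : ℕ) : MeasurableSet (unitaryBall N) := by
  apply measurableSet_le _ measurable_const
  fun_prop

theorem volume_unitaryBall_ne_zero (N : ℕ) : volume (unitaryBall N) ≠ 0 := by
  have ho : IsOpen {g : Fin N → ℂ | ∑ k, Real.pi * Complex.normSq (g k) < 1} := by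
    apply isOpen_lt _ continuous_const
    exact continuous_finsetSum _ fun k _ => continuous_const.mul
      (Complex.continuous_normSq.comp (continuous_apply k))
  have h := ho.measure_pos volume ⟨0, by simp⟩
  refine (h.trans_le (measure_mono fun g hg => ?_)).ne'
  simp only [unitaryBall, Set.mem_ofPred_eq] at hg ⊢
  exact hg.le

theorem volume_unitaryBall_ne_top (N : ℕ) : volume (unitaryBall N) ≠ ⊤ := by
  have : unitaryBall N ⊆ Metric.closedBall 0 1 := by
    intro g hg
    rw [mem_closedBall_zero_iff, pi_norm_le_iff_of_nonneg zero_le_one]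
    intro k
    have h1 : Real.pi * Complex.normSq (g k) ≤ 1 :=
      (Finset.single_le_sum (f := fun k => Real.pi * Complex.normSq (g k))
        (fun k _ => mul_nonneg Real.pi_pos.le (Complex.normSq_nonneg _))
        (Finset.mem_univ k)).trans hg
    have h2 := Complex.normSq_nonneg (g k)
    have h3 := Real.pi_gt_three
    rw [Complex.normSq_eq_norm_sq] at h1 h2
    have h4 : 0 ≤ ‖g k‖ := norm_nonneg _
    nlinarith
  exact ((measure_mono this).trans_lt (measure_closedBall_lt_top)).ne

theorem lintegral_unitaryBall_vecMul {N : ℕ} (u : Matrix.unitaryGroup (Fin N) ℂ)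
    {Φ : (Fin N → ℂ) → ENNReal} (hΦ : Measurable Φ) :
    ∫⁻ g in unitaryBall N, Φ (Matrix.vecMul g u.1) = ∫⁻ g in unitaryBall N, Φ g := by
  let T : (Fin N → ℂ) →ₗ[ℝ] (Fin N → ℂ) := (Matrix.vecMulLinear u.1).restrictScalars ℝ
  have hT : ∀ g, T g = Matrix.vecMul g u.1 := fun g => rfl
  have hTinj : Function.Injective T := by
    intro a b hab
    have h1 : u.1 * u.1.conjTranspose = 1 := Matrix.mem_unitaryGroup_iff.mp u.2
    have := congrArg (fun z => Matrix.vecMul z u.1.conjTranspose) hab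
    simpa [hT, Matrix.vecMul_vecMul, h1] using this
  have hdet : LinearMap.det T ≠ 0 := by
    rw [← isUnit_iff_ne_zero, ← LinearMap.isUnit_iff_isUnit_det, LinearMap.isUnit_iff_ker_eq_bot]
    exact LinearMap.ker_eq_bot.mpr hTinj
  have hTm : Measurable T := T.continuous_of_finiteDimensional.measurable
  have hpre : T ⁻¹' unitaryBall N = unitaryBall N := by
    ext g
    simp only [Set.mem_preimage, unitaryBall, Set.mem_ofPred_eq, ← Finset.mul_sum, hT,
      sum_normSq_vecMul]
  have hmap := Measure.map_linearMap_addHaar_eq_smul_addHaar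
    (volume : Measure (Fin N → ℂ)) hdet
  have hc : ENNReal.ofReal |(LinearMap.det T)⁻¹| = 1 := by
    have h1 := congrArg (fun m : Measure (Fin N → ℂ) => m (unitaryBall N)) hmap
    simp only [Measure.smul_apply, smul_eq_mul] at h1
    rw [Measure.map_apply hTm (measurableSet_unitaryBall N), hpre] at h1
    have h2 : 1 * volume (unitaryBall N)
        = ENNReal.ofReal |(LinearMap.det T)⁻¹| * volume (unitaryBall N) := by rwa [one_mul]
    exact ((ENNReal.mul_left_inj (volume_unitaryBall_ne_zero N)
      (volume_unitaryBall_ne_top N)).mp h2).symm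
  rw [hc, one_smul] at hmap
  have hmp : MeasurePreserving T volume volume := ⟨hTm, hmap⟩
  have := (hmp.restrict_preimage (measurableSet_unitaryBall N)).lintegral_comp hΦ
  rwa [hpre] at this

/-- The `i`-th row of a Haar unitary matrix is uniformly distributed on the sphere, in the form:
the mean of a scale invariant function is its mean over a ball. -/
theorem lintegral_haar_row_eq_ball {N : ℕ} (H : Measure (Matrix.unitaryGroup (Fin N) ℂ))
    [IsProbabilityMeasure H] [H.IsMulLeftInvariant] {Φ : (Fin N → ℂ) → ENNReal}
    (hΦ : Measurable Φ) (hs : ∀ (r : ℝ) (g : Fin N → ℂ), 0 < r → Φ ((r : ℂ) • g) = Φ g)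
    (i : Fin N) :
    volume (unitaryBall N) * ∫⁻ u, Φ (u.1 i) ∂H = ∫⁻ g in unitaryBall N, Φ g := by
  have : Nonempty (Fin N) := ⟨i⟩
  calc volume (unitaryBall N) * ∫⁻ u, Φ (u.1 i) ∂H
      = ∫⁻ g in unitaryBall N, ∫⁻ u, Φ (u.1 i) ∂H := by
        rw [setLIntegral_const, mul_comm]
    _ = ∫⁻ g in unitaryBall N, ∫⁻ u, Φ (Matrix.vecMul g u.1) ∂H := by
        apply lintegral_congr_ae
        have h0 : ∀ᵐ g ∂(volume.restrict (unitaryBall N)), g ≠ 0 := by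
          apply ae_restrict_of_ae
          exact Measure.ae_ne volume 0
        filter_upwards [h0] with g hg
        exact (lintegral_haar_vecMul H hs i hg).symm
    _ = ∫⁻ u, (∫⁻ g in unitaryBall N, Φ (Matrix.vecMul g u.1)) ∂H := by
        apply lintegral_lintegral_swap
        have : Continuous fun p : (Fin N → ℂ) × Matrix.unitaryGroup (Fin N) ℂ =>
            Matrix.vecMul p.1 p.2.1 :=
          continuous_fst.matrix_vecMul (continuous_subtype_val.comp continuous_snd)
        exact (hΦ.comp this.measurable).aemeasurable
    _ = ∫⁻ g in unitaryBall N, Φ g := by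
        simp only [lintegral_unitaryBall_vecMul _ hΦ, lintegral_const, measure_univ, mul_one]

/-- The image of Lebesgue measure on `ℂ` under `z ↦ π |z|²` is Lebesgue measure on the positive
half-line. -/
theorem map_pi_mul_normSq : (volume : Measure ℂ).map (fun z => Real.pi * Complex.normSq z)
    = volume.restrict (Set.Ioi 0) := by
  have hm : Measurable fun z : ℂ => Real.pi * Complex.normSq z := by fun_prop
  have hball : ∀ t : ℝ, volume {z : ℂ | Real.pi * Complex.normSq z ≤ t} = ENNReal.ofReal t := by
    intro t
    rcases lt_or_ge t 0 with ht | ht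
    · rw [ENNReal.ofReal_of_nonpos ht.le]
      convert! measure_empty (μ := (volume : Measure ℂ))
      ext z
      have := mul_nonneg Real.pi_pos.le (Complex.normSq_nonneg z)
      simp only [Set.mem_ofPred_eq, Set.mem_empty_iff_false, iff_false]
      linarith
    · have h1 : {z : ℂ | Real.pi * Complex.normSq z ≤ t}
          = Metric.closedBall 0 (√(t / Real.pi)) := by
        ext z
        rw [mem_closedBall_zero_iff, Set.mem_ofPred_eq, Complex.normSq_eq_norm_sq,
          Real.le_sqrt (norm_nonneg _) (by positivity), le_div_iff₀ Real.pi_pos, mul_comm]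
      rw [h1, Complex.volume_closedBall, ← ENNReal.ofReal_pow (Real.sqrt_nonneg _),
        Real.sq_sqrt (by positivity)]
      have h2 : (NNReal.pi : ENNReal) = ENNReal.ofReal Real.pi := by
        rw [← NNReal.coe_real_pi, ENNReal.ofReal_coe_nnreal]
      rw [h2, ← ENNReal.ofReal_mul (by positivity), div_mul_cancel₀ _ Real.pi_pos.ne']
  symm
  apply Measure.ext_of_Ioc
  intro a b hab
  rw [Measure.map_apply hm measurableSet_Ioc, Measure.restrict_apply measurableSet_Ioc,
    Set.Ioc_inter_Ioi, Real.volume_Ioc]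
  have h3 : (fun z : ℂ => Real.pi * Complex.normSq z) ⁻¹' Set.Ioc a b
      = {z : ℂ | Real.pi * Complex.normSq z ≤ b} \ {z : ℂ | Real.pi * Complex.normSq z ≤ a} := by
    ext z; simp [and_comm]
  have hsub : {z : ℂ | Real.pi * Complex.normSq z ≤ a} ⊆ {z : ℂ | Real.pi * Complex.normSq z ≤ b} := by
    intro z hz
    simp only [Set.mem_ofPred_eq] at hz ⊢
    exact hz.trans hab.le
  rw [h3, measure_sdiff hsub
    (measurableSet_le hm measurable_const).nullMeasurableSet (by rw [hball]; simp), hball, hball]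
  rcases le_total a 0 with ha | ha
  · rw [ENNReal.ofReal_of_nonpos ha, tsub_zero, sup_eq_right.mpr ha, sub_zero]
  · rw [sup_eq_left.mpr ha, ENNReal.ofReal_sub _ ha]

/-- The corner `{w | 0 < w_k, ∑ w_k ≤ 1}` of the positive orthant. -/
def corner (N : ℕ) : Set (Fin N → ℝ) := {w | (∀ k, 0 < w k) ∧ ∑ k, w k ≤ 1}

theorem measurableSet_corner (N : ℕ) : MeasurableSet (corner N) := by
  have : corner N = (⋂ k, {w | 0 < w k}) ∩ {w | ∑ k, w k ≤ 1} := by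
    ext w; simp [corner]
  rw [this]
  exact (MeasurableSet.iInter fun k => measurableSet_lt measurable_const (measurable_pi_apply k)).inter
    (measurableSet_le (by fun_prop) measurable_const)

theorem lintegral_unitaryBall_normSq {N : ℕ} {Ψ : (Fin N → ℝ) → ENNReal} (hΨ : Measurable Ψ) :
    ∫⁻ g in unitaryBall N, Ψ (fun k => Real.pi * Complex.normSq (g k)) = ∫⁻ w in corner N, Ψ w := by
  have hm : Measurable fun z : ℂ => Real.pi * Complex.normSq z := by fun_prop
  have hmap : (volume : Measure (Fin N → ℂ)).map (fun g k => Real.pi * Complex.normSq (g k))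
      = volume.restrict (Set.univ.pi fun _ => Set.Ioi 0) := by
    have hsf : SigmaFinite ((volume : Measure ℂ).map fun z => Real.pi * Complex.normSq z) := by
      rw [map_pi_mul_normSq]; infer_instance
    have := Measure.pi_map_pi (μ := fun _ : Fin N => (volume : Measure ℂ))
      (f := fun _ z => Real.pi * Complex.normSq z) fun _ => hm.aemeasurable
    rw [volume_pi, volume_pi, Measure.restrict_pi_pi, this]
    simp only [map_pi_mul_normSq]
  have hset : MeasurableSet {w : Fin N → ℝ | ∑ k, w k ≤ 1} :=
    measurableSet_le (by fun_prop) measurable_const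
  have hM : Measurable fun (g : Fin N → ℂ) k => Real.pi * Complex.normSq (g k) := by fun_prop
  have h1 : corner N = {w | ∑ k, w k ≤ 1} ∩ Set.univ.pi fun _ => Set.Ioi 0 := by
    ext w; simp [corner, and_comm]
  rw [h1, ← Measure.restrict_restrict hset, ← hmap, setLIntegral_map hset hΨ hM]
  rfl

/-- The vector of squared moduli of the entries of a row of a Haar unitary matrix is uniformly
distributed on the simplex. -/
theorem lintegral_haar_row {N : ℕ} (H : Measure (Matrix.unitaryGroup (Fin N) ℂ))
    [IsProbabilityMeasure H] [H.IsMulLeftInvariant] {Ψ : (Fin N → ℝ) → ENNReal}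
    (hΨ : Measurable Ψ) (hs : ∀ (r : ℝ) (w : Fin N → ℝ), 0 < r → Ψ (r • w) = Ψ w) (i : Fin N) :
    ∫⁻ u, Ψ (fun k => Complex.normSq (u.1 i k)) ∂H
      = (volume (unitaryBall N))⁻¹ * ∫⁻ w in corner N, Ψ w := by
  have h := lintegral_haar_row_eq_ball H (Φ := fun g => Ψ fun k => Real.pi * Complex.normSq (g k))
    (hΨ.comp (by fun_prop)) (fun r g hr => by
      rw [← hs (r ^ 2) (fun k => Real.pi * Complex.normSq (g k)) (by positivity)]
      congr 1
      funext k
      simp [Complex.normSq_ofReal]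
      ring) i
  rw [lintegral_unitaryBall_normSq hΨ] at h
  rw [← h, ← mul_assoc, ENNReal.inv_mul_cancel (volume_unitaryBall_ne_zero N)
    (volume_unitaryBall_ne_top N), one_mul]
  refine lintegral_congr fun u => ?_
  exact (hs Real.pi _ Real.pi_pos).symm

/-! ### Vandermonde determinants and interpolation -/


theorem vandermondeProd_eq_det {n : ℕ} (x : Fin n → ℝ) :
    vandermondeProd x = (Matrix.vandermonde x).det := (Matrix.det_vandermonde x).symm

theorem vandermondeProd_ne_zero_iff {n : ℕ} {x : Fin n → ℝ} :
    vandermondeProd x ≠ 0 ↔ Function.Injective x := by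
  rw [vandermondeProd_eq_det, Matrix.det_vandermonde_ne_zero_iff]

theorem vandermondeProd_pos {n : ℕ} {x : Fin n → ℝ} (hx : StrictMono x) :
    0 < vandermondeProd x :=
  Finset.prod_pos fun _ _ => Finset.prod_pos fun _ hk =>
    sub_pos.mpr (hx (Finset.mem_Ioi.mp hk))

theorem vandermondeProd_cons {n : ℕ} (t : ℝ) (y : Fin n → ℝ) :
    vandermondeProd (Fin.cons t y : Fin (n + 1) → ℝ)
      = (∏ j, (y j - t)) * vandermondeProd y := by
  simp [vandermondeProd, Fin.prod_univ_succ, Fin.prod_Ioi_succ]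

theorem prod_prod_erase_abs_sub {n : ℕ} (x : Fin n → ℝ) :
    ∏ k, ∏ l ∈ Finset.univ.erase k, |x k - x l| = |vandermondeProd x| ^ 2 := by
  have h1 : ∀ k : Fin n, ∏ l ∈ Finset.univ.erase k, |x k - x l|
      = (∏ l ∈ Finset.Ioi k, |x k - x l|) * ∏ l ∈ Finset.Iio k, |x k - x l| := by
    intro k
    rw [← Finset.prod_disjUnion (Finset.disjoint_Ioi_Iio k), Finset.Ioi_disjUnion_Iio,
      Finset.compl_eq_univ_sdiff, Finset.sdiff_singleton_eq_erase]
  have h2 : ∏ k, ∏ l ∈ Finset.Iio k, |x k - x l| = ∏ k, ∏ l ∈ Finset.Ioi k, |x k - x l| := by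
    rw [Finset.prod_comm' (t' := Finset.univ) (s' := fun l => Finset.Ioi l)
      (fun a b => by simp)]
    exact Finset.prod_congr rfl fun _ _ => Finset.prod_congr rfl fun _ _ => abs_sub_comm _ _
  rw [Finset.prod_congr rfl fun k _ => h1 k, Finset.prod_mul_distrib, h2, ← sq, vandermondeProd,
    Finset.abs_prod]
  simp only [Finset.abs_prod, abs_sub_comm]

theorem det_eval_eq_vandermonde_mul {N : ℕ} (q : Fin N → Polynomial ℝ)
    (hq : ∀ m, (q m).natDegree < N) (t : Fin N → ℝ) :
    (Matrix.of fun k m => (q m).eval (t k)).det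
      = (Matrix.vandermonde t).det * (Matrix.of fun (a : Fin N) m => (q m).coeff a).det := by
  rw [← Matrix.det_mul]
  congr 1
  ext k m
  rw [Matrix.of_apply, Matrix.mul_apply, Polynomial.eval_eq_sum_range' (hq m),
    ← Fin.sum_univ_eq_sum_range (fun a => (q m).coeff a * t k ^ a)]
  simp [Matrix.vandermonde_apply, mul_comm]

open Polynomial in
/-- The derivative `∏_j (X - y_j)` of `s ∏_j (X - y_j)` with respect to `s`, followed by its
derivatives with respect to the `y_m` divided by `-s`. -/
noncomputable def rootVariation {n : ℕ} (y : Fin n → ℝ) : Fin (n + 1) → ℝ[X] :=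
  Fin.cons (∏ j, (X - C (y j))) fun m => ∏ j ∈ Finset.univ.erase m, (X - C (y j))

theorem natDegree_rootVariation_lt {n : ℕ} (y : Fin n → ℝ) (m : Fin (n + 1)) :
    (rootVariation y m).natDegree < n + 1 := by
  refine Fin.cases ?_ (fun m => ?_) m
  · simp [rootVariation, Polynomial.natDegree_finsetProd_X_sub_C_eq_card]
  · simp only [rootVariation, Fin.cons_succ, Polynomial.natDegree_finsetProd_X_sub_C_eq_card]
    exact (Finset.card_le_univ _).trans_lt (by simp)

theorem det_eval_rootVariation_cons {n : ℕ} (t : ℝ) (y : Fin n → ℝ) :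
    (Matrix.of fun k m => (rootVariation y m).eval ((Fin.cons t y : Fin (n + 1) → ℝ) k)).det
      = (∏ j, (t - y j)) * ∏ k, ∏ l ∈ Finset.univ.erase k, (y k - y l) := by
  rw [Matrix.det_succ_column_zero, Fin.sum_univ_succ, Finset.sum_eq_zero, add_zero]
  · have : (Matrix.of fun k m => (rootVariation y m).eval
        ((Fin.cons t y : Fin (n + 1) → ℝ) k)).submatrix (Fin.succAbove 0) Fin.succ
        = Matrix.diagonal fun k => ∏ l ∈ Finset.univ.erase k, (y k - y l) := by
      ext a b
      by_cases hab : a = b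
      · subst hab
        simp [rootVariation, Polynomial.eval_prod]
      · simp only [rootVariation, Matrix.submatrix_apply, Matrix.of_apply, Fin.zero_succAbove,
          Fin.cons_succ, Polynomial.eval_prod, Polynomial.eval_sub, Polynomial.eval_X,
          Polynomial.eval_C, Matrix.diagonal_apply_ne _ hab]
        exact Finset.prod_eq_zero (Finset.mem_erase.mpr ⟨hab, Finset.mem_univ a⟩) (sub_self _)
    rw [this, Matrix.det_diagonal]
    simp [rootVariation, Polynomial.eval_prod]
  · intro k _
    have : ∏ j, (y k - y j) = 0 := Finset.prod_eq_zero (Finset.mem_univ k) (sub_self _)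
    simp [rootVariation, Polynomial.eval_prod, this]

/-- The Cauchy-type determinant behind the Jacobian: expanding in the monomial basis, the
dependence on `x` is a Vandermonde determinant, and the remaining factor is found by evaluating at
the points `y_j` and one more point. -/
theorem abs_det_eval_rootVariation {n : ℕ} (x : Fin (n + 1) → ℝ) {y : Fin n → ℝ}
    (hy : Function.Injective y) :
    |(Matrix.of fun k m => (rootVariation y m).eval (x k)).det|
      = |vandermondeProd x| * |vandermondeProd y| := by
  obtain ⟨t, ht⟩ := (Set.finite_range y).exists_notMem
  have ht' : ∏ j, (t - y j) ≠ 0 :=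
    Finset.prod_ne_zero_iff.mpr fun j _ => sub_ne_zero.mpr fun h => ht ⟨j, h.symm⟩
  have h1 := det_eval_eq_vandermonde_mul _ (natDegree_rootVariation_lt y) (Fin.cons t y)
  rw [det_eval_rootVariation_cons, ← vandermondeProd_eq_det, vandermondeProd_cons] at h1
  have h2 := congrArg abs h1
  have h6 : |∏ k, ∏ l ∈ Finset.univ.erase k, (y k - y l)| = |vandermondeProd y| ^ 2 := by
    rw [← prod_prod_erase_abs_sub]
    simp only [Finset.abs_prod]
  have h7 : |∏ j, (y j - t)| = |∏ j, (t - y j)| := by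
    rw [Finset.abs_prod, Finset.abs_prod]
    exact Finset.prod_congr rfl fun j _ => abs_sub_comm _ _
  rw [abs_mul, abs_mul, abs_mul, h6, h7] at h2
  rw [det_eval_eq_vandermonde_mul _ (natDegree_rootVariation_lt y) x, abs_mul,
    ← vandermondeProd_eq_det]
  congr 1
  have h3 : |vandermondeProd y| ≠ 0 := abs_ne_zero.mpr (vandermondeProd_ne_zero_iff.mpr hy)
  have h4 : |∏ j, (t - y j)| ≠ 0 := abs_ne_zero.mpr ht'
  rw [mul_assoc] at h2
  have h5 := mul_left_cancel₀ h4 h2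
  rw [sq] at h5
  exact (mul_left_cancel₀ h3 h5).symm

open Polynomial in
/-- The polynomial `∑_k w_k ∏_{l ≠ k} (X - x_l)`. -/
noncomputable def secularPoly {n : ℕ} (x w : Fin (n + 1) → ℝ) : ℝ[X] :=
  ∑ k, C (w k) * ∏ l, (X - C (x (k.succAbove l)))

open Polynomial in
/-- The polynomial `s ∏_j (X - y_j)`. -/
noncomputable def rootPoly {n : ℕ} (s : ℝ) (y : Fin n → ℝ) : ℝ[X] :=
  C s * ∏ j, (X - C (y j))

/-- The derivative of `∏_k (X - x_k)` at `x_k`. -/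
def nodeDeriv {n : ℕ} (x : Fin (n + 1) → ℝ) (k : Fin (n + 1)) : ℝ :=
  ∏ l, (x k - x (k.succAbove l))

theorem coeff_prod_X_sub_C {n : ℕ} (y : Fin n → ℝ) :
    (∏ j, (Polynomial.X - Polynomial.C (y j))).coeff n = 1 := by
  have h := Polynomial.monic_prod_X_sub_C y Finset.univ
  rw [Polynomial.Monic, Polynomial.leadingCoeff,
    Polynomial.natDegree_finsetProd_X_sub_C_eq_card] at h
  simpa using h

theorem coeff_prod_X_sub_C_of_lt {n : ℕ} (y : Fin n → ℝ) {m : ℕ} (hm : n < m) :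
    (∏ j, (Polynomial.X - Polynomial.C (y j))).coeff m = 0 := by
  apply Polynomial.coeff_eq_zero_of_natDegree_lt
  rw [Polynomial.natDegree_finsetProd_X_sub_C_eq_card]
  simpa using hm

theorem coeff_secularPoly {n : ℕ} (x w : Fin (n + 1) → ℝ) :
    (secularPoly x w).coeff n = ∑ k, w k := by
  simp [secularPoly, Polynomial.finsetSum_coeff, coeff_prod_X_sub_C]

theorem coeff_secularPoly_of_lt {n : ℕ} (x w : Fin (n + 1) → ℝ) {m : ℕ} (hm : n < m) :
    (secularPoly x w).coeff m = 0 := by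
  simp [secularPoly, Polynomial.finsetSum_coeff, coeff_prod_X_sub_C_of_lt _ hm]

theorem coeff_rootPoly {n : ℕ} (s : ℝ) (y : Fin n → ℝ) : (rootPoly s y).coeff n = s := by
  simp [rootPoly, coeff_prod_X_sub_C]

theorem coeff_rootPoly_of_lt {n : ℕ} (s : ℝ) (y : Fin n → ℝ) {m : ℕ} (hm : n < m) :
    (rootPoly s y).coeff m = 0 := by
  simp [rootPoly, coeff_prod_X_sub_C_of_lt _ hm]

theorem eval_secularPoly {n : ℕ} (x w : Fin (n + 1) → ℝ) (t : ℝ) :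
    (secularPoly x w).eval t = ∑ k, w k * ∏ l, (t - x (k.succAbove l)) := by
  simp [secularPoly, Polynomial.eval_finsetSum, Polynomial.eval_prod]

theorem eval_rootPoly {n : ℕ} (s : ℝ) (y : Fin n → ℝ) (t : ℝ) :
    (rootPoly s y).eval t = s * ∏ j, (t - y j) := by
  simp [rootPoly, Polynomial.eval_prod]

theorem eval_secularPoly_node {n : ℕ} (x w : Fin (n + 1) → ℝ) (k : Fin (n + 1)) :
    (secularPoly x w).eval (x k) = w k * nodeDeriv x k := by
  rw [eval_secularPoly, Finset.sum_eq_single k]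
  · rfl
  · intro j _ hj
    obtain ⟨l, hl⟩ := Fin.exists_succAbove_eq hj.symm
    rw [Finset.prod_eq_zero (Finset.mem_univ l) (by rw [hl, sub_self]), mul_zero]
  · simp

theorem secularPoly_eq_rootPoly_of_eval_nodes {n : ℕ} {x w : Fin (n + 1) → ℝ}
    (hx : Function.Injective x) {s : ℝ} {y : Fin n → ℝ}
    (h : ∀ k, (secularPoly x w).eval (x k) = (rootPoly s y).eval (x k)) :
    secularPoly x w = rootPoly s y := by
  rw [← sub_eq_zero]
  apply Polynomial.eq_zero_of_degree_lt_of_eval_index_eq_zero (v := x) Finset.univ hx.injOn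
  · rw [Finset.card_univ, Fintype.card_fin, Polynomial.degree_lt_iff_coeff_zero]
    intro m hm
    rw [Polynomial.coeff_sub, coeff_secularPoly_of_lt _ _ hm, coeff_rootPoly_of_lt _ _ hm, sub_zero]
  · intro k _
    rw [Polynomial.eval_sub, h k, sub_self]

theorem secularPoly_eq_rootPoly_of_isRoot {n : ℕ} {x w : Fin (n + 1) → ℝ} {y : Fin n → ℝ}
    (hy : Function.Injective y) (h : ∀ j, (secularPoly x w).eval (y j) = 0) :
    secularPoly x w = rootPoly (∑ k, w k) y := by
  rw [← sub_eq_zero]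
  apply Polynomial.eq_zero_of_degree_lt_of_eval_index_eq_zero (v := y) Finset.univ hy.injOn
  · rw [Finset.card_univ, Fintype.card_fin, Polynomial.degree_lt_iff_coeff_zero]
    intro m hm
    rcases hm.eq_or_lt with rfl | hm
    · rw [Polynomial.coeff_sub, coeff_secularPoly, coeff_rootPoly, sub_self]
    · rw [Polynomial.coeff_sub, coeff_secularPoly_of_lt _ _ hm, coeff_rootPoly_of_lt _ _ hm,
        sub_zero]
  · intro j _
    rw [Polynomial.eval_sub, h j, eval_rootPoly,
      Finset.prod_eq_zero (Finset.mem_univ j) (sub_self _), mul_zero, sub_zero]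

theorem secularRoots_eq_of_secularPoly_eq {n : ℕ} {x w : Fin (n + 1) → ℝ} {y : Fin n → ℝ}
    (hy : Monotone y) {s : ℝ} (hs : 0 < s) (h : secularPoly x w = rootPoly s y) :
    secularRoots x w = y := by
  rw [← sortedRoots_eq hy hs, secularRoots]
  congr 1
  funext j
  rw [← eval_rootPoly, ← h, eval_secularPoly]

/-! ### The change of variables from weights to interlacing roots -/


theorem prod_erase_eq_prod_ite {M ι : Type*} [CommMonoid M] [Fintype ι] [DecidableEq ι] (m : ι)
    (f : ι → M) : ∏ j ∈ Finset.univ.erase m, f j = ∏ j, if j = m then 1 else f j := by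
  rw [← Finset.mul_prod_erase Finset.univ _ (Finset.mem_univ m), if_pos rfl, one_mul]
  exact Finset.prod_congr rfl fun j hj => (if_neg (Finset.ne_of_mem_erase hj)).symm

theorem prod_erase_succ {M : Type*} [CommMonoid M] {n : ℕ} (m : Fin n) (f : Fin (n + 1) → M) :
    ∏ j ∈ Finset.univ.erase m.succ, f j = f 0 * ∏ j ∈ Finset.univ.erase m, f j.succ := by
  rw [prod_erase_eq_prod_ite, prod_erase_eq_prod_ite, Fin.prod_univ_succ,
    if_neg (Fin.succ_ne_zero m).symm]
  simp

theorem prod_erase_zero {M : Type*} [CommMonoid M] {n : ℕ} (f : Fin (n + 1) → M) :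
    ∏ j ∈ Finset.univ.erase 0, f j = ∏ j : Fin n, f j.succ := by
  rw [prod_erase_eq_prod_ite, Fin.prod_univ_succ]
  simp

theorem prod_abs_nodeDeriv {n : ℕ} (x : Fin (n + 1) → ℝ) :
    ∏ k, |nodeDeriv x k| = |vandermondeProd x| ^ 2 := by
  rw [← prod_prod_erase_abs_sub]
  refine Finset.prod_congr rfl fun k _ => ?_
  rw [prod_erase_eq_prod_succAbove k fun l => |x k - x l|, nodeDeriv, Finset.abs_prod]

theorem nodeDeriv_ne_zero {n : ℕ} {x : Fin (n + 1) → ℝ} (hx : Function.Injective x)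
    (k : Fin (n + 1)) : nodeDeriv x k ≠ 0 :=
  Finset.prod_ne_zero_iff.mpr fun l _ => sub_ne_zero.mpr fun h =>
    Fin.succAbove_ne k l (hx h).symm

/-- The weights `w_k` for which `∑_k w_k ∏_{l ≠ k} (X - x_l)` is the polynomial with leading
coefficient `v 0` and roots `v 1, …, v n`. -/
noncomputable def spectralWeights {n : ℕ} (x v : Fin (n + 1) → ℝ) : Fin (n + 1) → ℝ :=
  fun k => (v 0 * ∏ j : Fin n, (x k - v j.succ)) / nodeDeriv x k

/-- The Jacobian matrix of `spectralWeights x`. -/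
noncomputable def weightsJacobian {n : ℕ} (x v : Fin (n + 1) → ℝ) :
    Matrix (Fin (n + 1)) (Fin (n + 1)) ℝ :=
  Matrix.of fun k m => (nodeDeriv x k)⁻¹ *
    (Matrix.of fun k m => (Fin.cons 1 fun _ => -v 0 : Fin (n + 1) → ℝ) m *
      (Matrix.of fun k m => (rootVariation (Fin.tail v) m).eval (x k)) k m) k m

theorem hasFDerivAt_spectralWeights {n : ℕ} (x v : Fin (n + 1) → ℝ) :
    HasFDerivAt (spectralWeights x)
      (LinearMap.toContinuousLinearMap (Matrix.toLin' (weightsJacobian x v))) v := by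
  rw [hasFDerivAt_pi']
  intro k
  let a : Fin (n + 1) → ℝ := Fin.cons 0 fun _ => x k
  let b : Fin (n + 1) → ℝ := Fin.cons 1 fun _ => -1
  have hF : (fun v => spectralWeights x v k)
      = fun v => (∏ m, (a m + b m * v m)) * (nodeDeriv x k)⁻¹ := by
    funext v
    rw [spectralWeights, Fin.prod_univ_succ, div_eq_mul_inv]
    simp [a, b, sub_eq_add_neg]
  have hm : ∀ m ∈ Finset.univ, HasFDerivAt (fun v : Fin (n + 1) → ℝ => a m + b m * v m)
      (b m • (ContinuousLinearMap.proj m : (Fin (n + 1) → ℝ) →L[ℝ] ℝ)) v := fun m _ =>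
    ((hasFDerivAt_apply m v).const_mul (b m)).const_add (a m)
  have hd := (HasFDerivAt.finsetProd hm).mul_const (nodeDeriv x k)⁻¹
  rw [hF]
  refine hd.congr_fderiv ?_
  ext w
  simp only [FunLike.coe_smul, Pi.smul_apply, FunLike.coe_sum,
    Finset.sum_apply, ContinuousLinearMap.proj_apply, smul_eq_mul, ContinuousLinearMap.coe_comp,
    Function.comp_apply, LinearMap.coe_toContinuousLinearMap', Matrix.toLin'_apply, Matrix.mulVec,
    dotProduct]
  rw [Finset.mul_sum]
  refine Finset.sum_congr rfl fun m _ => ?_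
  rw [← mul_assoc, ← mul_assoc]
  congr 1
  simp only [weightsJacobian, Matrix.of_apply]
  rw [mul_assoc]
  congr 1
  refine Fin.cases ?_ (fun m => ?_) m
  · rw [prod_erase_zero]
    simp [a, b, rootVariation, Fin.tail, Polynomial.eval_prod, sub_eq_add_neg]
  · rw [prod_erase_succ]
    simp [a, b, rootVariation, Fin.tail, Polynomial.eval_prod, sub_eq_add_neg]

theorem abs_det_weightsJacobian {n : ℕ} {x v : Fin (n + 1) → ℝ} (hx : Function.Injective x)
    (hy : Function.Injective (Fin.tail v)) :
    |(weightsJacobian x v).det|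
      = |v 0| ^ n * (|vandermondeProd (Fin.tail v)| / |vandermondeProd x|) := by
  have h0 : |vandermondeProd x| ≠ 0 := abs_ne_zero.mpr (vandermondeProd_ne_zero_iff.mpr hx)
  have h1 : |∏ m, (Fin.cons 1 fun _ => -v 0 : Fin (n + 1) → ℝ) m| = |v 0| ^ n := by
    simp [Fin.prod_univ_succ, abs_pow]
  have h2 : |∏ k, (nodeDeriv x k)⁻¹| = (|vandermondeProd x| ^ 2)⁻¹ := by
    rw [Finset.prod_inv_distrib, abs_inv, Finset.abs_prod, prod_abs_nodeDeriv]
  rw [weightsJacobian, Matrix.det_mul_column, Matrix.det_mul_row, abs_mul, abs_mul,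
    abs_det_eval_rootVariation x hy, h1, h2]
  field_simp

/-- The vectors `y` that strictly interlace the increasing vector `x`. -/
def interlacing {n : ℕ} (x : Fin (n + 1) → ℝ) : Set (Fin n → ℝ) :=
  {y | ∀ l, x l.castSucc < y l ∧ y l < x l.succ}

theorem mem_interlacing {n : ℕ} {x : Fin (n + 1) → ℝ} {y : Fin n → ℝ} :
    y ∈ interlacing x ↔ ∀ l, x l.castSucc < y l ∧ y l < x l.succ := by
  simp [interlacing]

theorem strictMono_left_of_interlacing {n : ℕ} {x : Fin (n + 1) → ℝ} {y : Fin n → ℝ}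
    (hy : y ∈ interlacing x) : StrictMono x :=
  Fin.strictMono_iff_lt_succ.mpr fun l =>
    (mem_interlacing.mp hy l).1.trans (mem_interlacing.mp hy l).2

theorem strictMono_of_mem_interlacing {n : ℕ} {x : Fin (n + 1) → ℝ} {y : Fin n → ℝ}
    (hy : y ∈ interlacing x) : StrictMono y := by
  intro a b hab
  have h1 : x a.succ ≤ x b.castSucc := (strictMono_left_of_interlacing hy).monotone (by
    rw [Fin.le_def, Fin.val_succ, Fin.val_castSucc]; exact hab)
  exact ((mem_interlacing.mp hy a).2.trans_le h1).trans (mem_interlacing.mp hy b).1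

theorem prod_sub_div_nodeDeriv_pos {n : ℕ} {x : Fin (n + 1) → ℝ}
    {y : Fin n → ℝ} (hy : y ∈ interlacing x) (k : Fin (n + 1)) :
    0 < (∏ j, (x k - y j)) / nodeDeriv x k := by
  have hx := strictMono_left_of_interlacing hy
  rw [mem_interlacing] at hy
  rw [nodeDeriv, ← Finset.prod_div_distrib]
  refine Finset.prod_pos fun l _ => ?_
  rcases lt_or_ge l.castSucc k with h | h
  · rw [Fin.succAbove_of_castSucc_lt _ _ h]
    have h1 : x l.succ ≤ x k := hx.monotone (by
      rw [Fin.le_def, Fin.val_succ]; exact h)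
    exact div_pos (by linarith [(hy l).2]) (sub_pos.mpr (hx h))
  · rw [Fin.succAbove_of_le_castSucc _ _ h]
    have h1 : x k ≤ x l.castSucc := hx.monotone h
    have h2 : x k < x l.succ := h1.trans_lt ((hy l).1.trans (hy l).2)
    exact div_pos_of_neg_of_neg (by linarith [(hy l).1]) (by linarith)

theorem nodeDeriv_castSucc_mul_succ_neg {n : ℕ} {x : Fin (n + 1) → ℝ} (hx : StrictMono x)
    (l : Fin n) : nodeDeriv x l.castSucc * nodeDeriv x l.succ < 0 := by
  -- The sign of `nodeDeriv` is read off from any interlacing vector, such as the midpoints.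
  let y : Fin n → ℝ := fun l => (x l.castSucc + x l.succ) / 2
  have hy : y ∈ interlacing x := by
    rw [mem_interlacing]
    intro l
    have := hx (Fin.castSucc_lt_succ (i := l))
    constructor <;> simp only [y] <;> linarith
  have hy' := mem_interlacing.mp hy
  have h1 := mul_pos (prod_sub_div_nodeDeriv_pos hy l.castSucc) (prod_sub_div_nodeDeriv_pos hy l.succ)
  have h2 : (∏ j, (x l.castSucc - y j)) * (∏ j, (x l.succ - y j)) < 0 := by
    rw [← Finset.prod_mul_distrib, ← Finset.mul_prod_erase Finset.univ _ (Finset.mem_univ l)]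
    refine mul_neg_of_neg_of_pos (mul_neg_of_neg_of_pos (by linarith [(hy' l).1])
      (by linarith [(hy' l).2])) (Finset.prod_pos fun j hj => ?_)
    rcases lt_or_gt_of_ne (Finset.ne_of_mem_erase hj) with h | h
    · have h3 : x j.succ ≤ x l.castSucc := hx.monotone (by
        rw [Fin.le_def, Fin.val_succ, Fin.val_castSucc]; exact h)
      have h4 := hx (Fin.castSucc_lt_succ (i := l))
      exact mul_pos (by linarith [(hy' j).2]) (by linarith [(hy' j).2])
    · have h3 : x l.succ ≤ x j.castSucc := hx.monotone (by
        rw [Fin.le_def, Fin.val_succ, Fin.val_castSucc]; exact h)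
      have h4 := hx (Fin.castSucc_lt_succ (i := l))
      exact mul_pos_of_neg_of_neg (by linarith [(hy' j).1]) (by linarith [(hy' j).1])
  rw [div_mul_div_comm] at h1
  by_contra h3
  exact absurd (div_nonpos_of_nonpos_of_nonneg h2.le (not_lt.mp h3)) (not_le.mpr h1)

theorem exists_root_of_eval_mul_neg (p : Polynomial ℝ) {a b : ℝ} (hab : a < b)
    (h : p.eval a * p.eval b < 0) : ∃ t, a < t ∧ t < b ∧ p.eval t = 0 := by
  rcases mul_neg_iff.mp h with ⟨h1, h2⟩ | ⟨h1, h2⟩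
  · obtain ⟨t, ht, h⟩ := intermediate_value_Ioo' hab.le p.continuous.continuousOn
      (show (0 : ℝ) ∈ Set.Ioo _ _ from ⟨h2, h1⟩)
    exact ⟨t, ht.1, ht.2, h⟩
  · obtain ⟨t, ht, h⟩ := intermediate_value_Ioo hab.le p.continuous.continuousOn
      (show (0 : ℝ) ∈ Set.Ioo _ _ from ⟨h1, h2⟩)
    exact ⟨t, ht.1, ht.2, h⟩

theorem secularPoly_spectralWeights {n : ℕ} {x : Fin (n + 1) → ℝ} (hx : Function.Injective x)
    (v : Fin (n + 1) → ℝ) :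
    secularPoly x (spectralWeights x v) = rootPoly (v 0) (Fin.tail v) := by
  refine secularPoly_eq_rootPoly_of_eval_nodes hx fun k => ?_
  rw [eval_secularPoly_node, spectralWeights, div_mul_cancel₀ _ (nodeDeriv_ne_zero hx k),
    eval_rootPoly]
  rfl

theorem sum_spectralWeights {n : ℕ} {x : Fin (n + 1) → ℝ} (hx : Function.Injective x)
    (v : Fin (n + 1) → ℝ) : ∑ k, spectralWeights x v k = v 0 := by
  rw [← coeff_secularPoly x, secularPoly_spectralWeights hx, coeff_rootPoly]

/-- The parameters `v` consisting of a total weight `v 0 ∈ (0, 1]` and a vector `v 1, …, v n`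
interlacing `x`. -/
def weightParams {n : ℕ} (x : Fin (n + 1) → ℝ) : Set (Fin (n + 1) → ℝ) :=
  {v | v 0 ∈ Set.Ioc 0 1 ∧ Fin.tail v ∈ interlacing x}

theorem mem_weightParams {n : ℕ} {x v : Fin (n + 1) → ℝ} :
    v ∈ weightParams x ↔ v 0 ∈ Set.Ioc 0 1 ∧ Fin.tail v ∈ interlacing x := by
  simp [weightParams]

theorem secularRoots_spectralWeights {n : ℕ} {x v : Fin (n + 1) → ℝ} (hv : v ∈ weightParams x) :
    secularRoots x (spectralWeights x v) = Fin.tail v := by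
  rw [mem_weightParams] at hv
  exact secularRoots_eq_of_secularPoly_eq (strictMono_of_mem_interlacing hv.2).monotone hv.1.1
    (secularPoly_spectralWeights (strictMono_left_of_interlacing hv.2).injective v)

theorem injOn_spectralWeights {n : ℕ} (x : Fin (n + 1) → ℝ) :
    Set.InjOn (spectralWeights x) (weightParams x) := by
  intro v hv v' hv' h
  have hx := (strictMono_left_of_interlacing (mem_weightParams.mp hv).2).injective
  have h0 : v 0 = v' 0 := by rw [← sum_spectralWeights hx v, h, sum_spectralWeights hx]
  have h1 : Fin.tail v = Fin.tail v' := by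
    rw [← secularRoots_spectralWeights hv, h, secularRoots_spectralWeights hv']
  rw [← Fin.cons_self_tail v, ← Fin.cons_self_tail v', h0, h1]

theorem mem_corner {N : ℕ} {w : Fin N → ℝ} : w ∈ corner N ↔ (∀ k, 0 < w k) ∧ ∑ k, w k ≤ 1 := by
  simp [corner]

/-- Positive weights have interlacing roots, by the intermediate value theorem. -/
theorem exists_interlacing_roots {n : ℕ} {x w : Fin (n + 1) → ℝ} (hx : StrictMono x)
    (hw : ∀ k, 0 < w k) : ∃ y ∈ interlacing x, secularPoly x w = rootPoly (∑ k, w k) y := by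
  have hroot : ∀ l : Fin n, ∃ t, x l.castSucc < t ∧ t < x l.succ ∧
      (secularPoly x w).eval t = 0 := by
    intro l
    apply exists_root_of_eval_mul_neg _ (hx (Fin.castSucc_lt_succ (i := l)))
    rw [eval_secularPoly_node, eval_secularPoly_node, mul_mul_mul_comm]
    exact mul_neg_of_pos_of_neg (mul_pos (hw _) (hw _)) (nodeDeriv_castSucc_mul_succ_neg hx l)
  choose y hy1 hy2 hy3 using hroot
  have hy : y ∈ interlacing x := mem_interlacing.mpr fun l => ⟨hy1 l, hy2 l⟩
  exact ⟨y, hy, secularPoly_eq_rootPoly_of_isRoot (strictMono_of_mem_interlacing hy).injective hy3⟩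

theorem image_spectralWeights {n : ℕ} {x : Fin (n + 1) → ℝ} (hx : StrictMono x) :
    spectralWeights x '' weightParams x = corner (n + 1) := by
  ext w
  rw [mem_corner]
  constructor
  · rintro ⟨v, hv, rfl⟩
    rw [mem_weightParams] at hv
    refine ⟨fun k => ?_, ?_⟩
    · rw [spectralWeights, mul_div_assoc]
      exact mul_pos hv.1.1 (prod_sub_div_nodeDeriv_pos hv.2 k)
    · rw [sum_spectralWeights hx.injective]
      exact hv.1.2
  · rintro ⟨hw, hs⟩
    obtain ⟨y, hy, hp⟩ := exists_interlacing_roots hx hw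
    refine ⟨Fin.cons (∑ k, w k) y, mem_weightParams.mpr ⟨⟨?_, ?_⟩, ?_⟩, ?_⟩
    · exact Finset.sum_pos (fun k _ => hw k) Finset.univ_nonempty
    · exact hs
    · rwa [Fin.tail_cons]
    · funext k
      rw [spectralWeights, div_eq_iff (nodeDeriv_ne_zero hx.injective k),
        ← eval_secularPoly_node, hp, eval_rootPoly]
      simp

theorem measurableSet_interlacing {n : ℕ} (x : Fin (n + 1) → ℝ) :
    MeasurableSet (interlacing x) := by
  have : interlacing x = ⋂ l, ({y | x l.castSucc < y l} ∩ {y | y l < x l.succ}) := by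
    ext y; simp [mem_interlacing]
  rw [this]
  exact MeasurableSet.iInter fun l =>
    (measurableSet_lt measurable_const (measurable_pi_apply l)).inter
      (measurableSet_lt (measurable_pi_apply l) measurable_const)

theorem measurableSet_weightParams {n : ℕ} (x : Fin (n + 1) → ℝ) :
    MeasurableSet (weightParams x) := by
  have h : weightParams x = (fun v => v 0) ⁻¹' Set.Ioc 0 1 ∩ Fin.tail ⁻¹' interlacing x := by
    ext v; simp [mem_weightParams]
  rw [h]
  refine (measurable_pi_apply 0 measurableSet_Ioc).inter
    ((measurable_pi_iff.mpr fun l => ?_) (measurableSet_interlacing x))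
  exact measurable_pi_apply l.succ

theorem measurable_vandermondeProd {n : ℕ} : Measurable (vandermondeProd (n := n)) := by
  unfold vandermondeProd
  fun_prop

/-- If the weights are uniformly distributed, the zeros of `∑_k w_k ∏_{l ≠ k} (t - x_l)` have
density proportional to `Δ(y) / Δ(x)` on the set of vectors interlacing `x`. -/
theorem lintegral_corner_secularRoots {n : ℕ} {x : Fin (n + 1) → ℝ} (hx : StrictMono x)
    {ψ : (Fin n → ℝ) → ENNReal} (hψ : Measurable ψ) :
    ∫⁻ w in corner (n + 1), ψ (secularRoots x w)
      = (∫⁻ s in Set.Ioc (0 : ℝ) 1, ENNReal.ofReal (|s| ^ n)) *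
        ∫⁻ y in interlacing x, ENNReal.ofReal (|vandermondeProd y| / |vandermondeProd x|) * ψ y := by
  rw [← image_spectralWeights hx,
    lintegral_image_eq_lintegral_abs_det_fderiv_mul volume (measurableSet_weightParams x)
      (fun v _ => (hasFDerivAt_spectralWeights x v).hasFDerivWithinAt) (injOn_spectralWeights x)]
  have h1 : ∀ v ∈ weightParams x,
      ENNReal.ofReal |(LinearMap.toContinuousLinearMap
        (Matrix.toLin' (weightsJacobian x v))).det| * ψ (secularRoots x (spectralWeights x v))
      = ENNReal.ofReal (|v 0| ^ n) *
        (ENNReal.ofReal (|vandermondeProd (Fin.tail v)| / |vandermondeProd x|)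
          * ψ (Fin.tail v)) := by
    intro v hv
    have hy := (strictMono_of_mem_interlacing (mem_weightParams.mp hv).2).injective
    rw [secularRoots_spectralWeights hv, ContinuousLinearMap.det,
      LinearMap.coe_toContinuousLinearMap, LinearMap.det_toLin',
      abs_det_weightsJacobian hx.injective hy, ENNReal.ofReal_mul (by positivity), mul_assoc]
  rw [setLIntegral_congr_fun (measurableSet_weightParams x) h1]
  let e := MeasurableEquiv.piFinSuccAbove (fun _ : Fin (n + 1) => ℝ) 0
  have he : MeasurePreserving e volume volume :=
    volume_preserving_piFinSuccAbove (fun _ : Fin (n + 1) => ℝ) 0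
  have hpre : weightParams x = e ⁻¹' (Set.Ioc (0 : ℝ) 1 ×ˢ interlacing x) := by
    ext v
    rw [mem_weightParams, Set.mem_preimage, Set.mem_prod]
    rfl
  have hmeas : Measurable fun y : Fin n → ℝ =>
      ENNReal.ofReal (|vandermondeProd y| / |vandermondeProd x|) * ψ y := by
    refine (Measurable.ennreal_ofReal ?_).mul hψ
    exact measurable_vandermondeProd.abs.div_const _
  have hs : Measurable fun s : ℝ => ENNReal.ofReal (|s| ^ n) := by fun_prop
  rw [← lintegral_prod_mul hs.aemeasurable hmeas.aemeasurable, Measure.prod_restrict,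
    ← Measure.volume_eq_prod, hpre,
    ← (he.restrict_preimage_emb e.measurableEmbedding _).lintegral_comp_emb e.measurableEmbedding]
  rfl

/-! ### The law of the compression given the spectrum -/


theorem secularRoots_smul {n : ℕ} {x w : Fin (n + 1) → ℝ} (hx : StrictMono x)
    (hw : ∀ k, 0 < w k) {r : ℝ} (hr : 0 < r) : secularRoots x (r • w) = secularRoots x w := by
  obtain ⟨y, hy, hp⟩ := exists_interlacing_roots hx hw
  have hmono := (strictMono_of_mem_interlacing hy).monotone
  have hs : 0 < ∑ k, w k := Finset.sum_pos (fun k _ => hw k) Finset.univ_nonempty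
  have hp' : secularPoly x (r • w) = rootPoly (r * ∑ k, w k) y := by
    have h1 : secularPoly x (r • w) = Polynomial.C r * secularPoly x w := by
      simp [secularPoly, Finset.mul_sum, mul_assoc]
    rw [h1, hp, rootPoly, rootPoly, Polynomial.C_mul, mul_assoc]
  rw [secularRoots_eq_of_secularPoly_eq hmono hs hp,
    secularRoots_eq_of_secularPoly_eq hmono (mul_pos hr hs) hp']

/-- The normalization constant of the law of the interlacing roots; only its independence of the
vector `x` that is interlaced matters. -/
noncomputable def cornerConst (n : ℕ) : ENNReal :=
  (volume (unitaryBall (n + 1)))⁻¹ * ∫⁻ s in Set.Ioc (0 : ℝ) 1, ENNReal.ofReal (|s| ^ n)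

instance instSecondCountableTopologyUnitaryGroup {N : ℕ} :
    SecondCountableTopology (Matrix.unitaryGroup (Fin N) ℂ) := by
  have : SecondCountableTopology (Matrix (Fin N) (Fin N) ℂ) :=
    inferInstanceAs (SecondCountableTopology (Fin N → Fin N → ℂ))
  exact TopologicalSpace.Subtype.secondCountableTopology _

theorem measurable_normSq_row {N : ℕ} (i : Fin N) :
    Measurable fun (u : Matrix.unitaryGroup (Fin N) ℂ) k => Complex.normSq (u.1 i k) :=
  measurable_pi_iff.mpr fun k => Complex.continuous_normSq.measurable.comp
    ((measurable_matrix_apply i k).comp measurable_subtype_coe)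

theorem ae_normSq_haar_row_pos {N : ℕ} (H : Measure (Matrix.unitaryGroup (Fin N) ℂ))
    [IsProbabilityMeasure H] [H.IsMulLeftInvariant] (i : Fin N) :
    ∀ᵐ u ∂H, ∀ k, 0 < Complex.normSq (u.1 i k) := by
  have hS : MeasurableSet {w : Fin N → ℝ | ∀ k, 0 < w k} := by
    have : {w : Fin N → ℝ | ∀ k, 0 < w k} = ⋂ k, {w | 0 < w k} := by ext; simp
    rw [this]
    exact MeasurableSet.iInter fun k => measurableSet_lt measurable_const (measurable_pi_apply k)
  have h := lintegral_haar_row H (Ψ := {w : Fin N → ℝ | ∀ k, 0 < w k}ᶜ.indicator 1)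
    (measurable_one.indicator hS.compl) (fun r w hr => by
      have h2 : r • w ∈ {w : Fin N → ℝ | ∀ k, 0 < w k}ᶜ ↔ w ∈ {w : Fin N → ℝ | ∀ k, 0 < w k}ᶜ := by
        simp [hr]
      by_cases h3 : w ∈ {w : Fin N → ℝ | ∀ k, 0 < w k}ᶜ
      · rw [Set.indicator_of_mem h3, Set.indicator_of_mem (h2.mpr h3)]
        rfl
      · rw [Set.indicator_of_notMem h3, Set.indicator_of_notMem (fun h4 => h3 (h2.mp h4))]) i
  rw [setLIntegral_congr_fun (g := 0) (measurableSet_corner N) (fun w hw => by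
    rw [Set.indicator_of_notMem]
    · rfl
    · simpa using (mem_corner.mp hw).1)] at h
  simp only [Pi.zero_apply, lintegral_zero, mul_zero] at h
  have hm : Measurable fun u : Matrix.unitaryGroup (Fin N) ℂ =>
      ({w : Fin N → ℝ | ∀ k, 0 < w k}ᶜ.indicator 1 (fun k => Complex.normSq (u.1 i k)) : ENNReal) :=
    (measurable_one.indicator hS.compl).comp (measurable_normSq_row i)
  filter_upwards [(lintegral_eq_zero_iff hm).mp h] with u hu
  by_contra h5
  have h6 : (fun k => Complex.normSq (u.1 i k)) ∈ {w : Fin N → ℝ | ∀ k, 0 < w k}ᶜ := by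
    simpa using h5
  rw [Set.indicator_of_mem h6] at hu
  exact one_ne_zero hu

/-- The law of the spectrum of the compression of a fixed matrix with spectrum `x` by a Haar
unitary: it has density proportional to `Δ(y) / Δ(x)` on the set of vectors interlacing `x`. -/
theorem lintegral_haar_secularRoots {n : ℕ} (H : Measure (Matrix.unitaryGroup (Fin (n + 1)) ℂ))
    [IsProbabilityMeasure H] [H.IsMulLeftInvariant] (i : Fin (n + 1)) {x : Fin (n + 1) → ℝ}
    (hx : StrictMono x) {ψ : (Fin n → ℝ) → ENNReal} (hψ : Measurable ψ) :
    ∫⁻ u, ψ (secularRoots x fun k => Complex.normSq (u.1 i k)) ∂H = cornerConst n *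
      ∫⁻ y in interlacing x, ENNReal.ofReal (|vandermondeProd y| / |vandermondeProd x|) * ψ y := by
  have hS : MeasurableSet {w : Fin (n + 1) → ℝ | ∀ k, 0 < w k} := by
    have : {w : Fin (n + 1) → ℝ | ∀ k, 0 < w k} = ⋂ k, {w | 0 < w k} := by ext; simp
    rw [this]
    exact MeasurableSet.iInter fun k => measurableSet_lt measurable_const (measurable_pi_apply k)
  have hm : Measurable fun w => ψ (secularRoots x w) :=
    hψ.comp (measurable_secularRoots.comp (measurable_const.prodMk measurable_id))
  have h := lintegral_haar_row H
    (Ψ := {w : Fin (n + 1) → ℝ | ∀ k, 0 < w k}.indicator fun w => ψ (secularRoots x w))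
    (hm.indicator hS) (fun r w hr => by
      have h2 : r • w ∈ {w : Fin (n + 1) → ℝ | ∀ k, 0 < w k} ↔
          w ∈ {w : Fin (n + 1) → ℝ | ∀ k, 0 < w k} := by
        simp [hr]
      by_cases h3 : w ∈ {w : Fin (n + 1) → ℝ | ∀ k, 0 < w k}
      · rw [Set.indicator_of_mem h3, Set.indicator_of_mem (h2.mpr h3),
          secularRoots_smul hx (by simpa using h3) hr]
      · rw [Set.indicator_of_notMem h3, Set.indicator_of_notMem (fun h4 => h3 (h2.mp h4))]) i
  have hcone : ∀ w ∈ corner (n + 1), w ∈ {w : Fin (n + 1) → ℝ | ∀ k, 0 < w k} :=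
    fun w hw => by simpa using (mem_corner.mp hw).1
  rw [setLIntegral_congr_fun (measurableSet_corner _)
    fun w hw => Set.indicator_of_mem (hcone w hw) fun w => ψ (secularRoots x w),
    lintegral_corner_secularRoots hx hψ, ← mul_assoc] at h
  rw [cornerConst, ← h]
  refine lintegral_congr_ae ?_
  filter_upwards [ae_normSq_haar_row_pos H i] with u hu
  rw [Set.indicator_of_mem]
  simpa using hu

theorem measurable_restriction {n : ℕ} (i : Fin (n + 1)) :
    Measurable fun p : Matrix (Fin (n + 1)) (Fin (n + 1)) ℂ ×
      Matrix.unitaryGroup (Fin (n + 1)) ℂ => restriction i p.1 p.2 := by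
  have h : Continuous fun p : Matrix (Fin (n + 1)) (Fin (n + 1)) ℂ ×
      Matrix.unitaryGroup (Fin (n + 1)) ℂ => restriction i p.1 p.2 := by
    unfold restriction
    have h2 : Continuous fun p : Matrix (Fin (n + 1)) (Fin (n + 1)) ℂ ×
      Matrix.unitaryGroup (Fin (n + 1)) ℂ => p.2.1 := continuous_subtype_val.comp continuous_snd
    exact ((h2.matrix_mul continuous_fst).matrix_mul h2.matrix_conjTranspose).matrix_submatrix _ _
  have hB : BorelSpace (Matrix (Fin (n + 1)) (Fin (n + 1)) ℂ ×
      Matrix.unitaryGroup (Fin (n + 1)) ℂ) := by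
    have : SecondCountableTopology (Matrix (Fin (n + 1)) (Fin (n + 1)) ℂ) :=
      inferInstanceAs (SecondCountableTopology (Fin (n + 1) → Fin (n + 1) → ℂ))
    infer_instance
  exact h.measurable

/-- Conditioning on `X`: the spectrum of the compression of `X` by an independent Haar unitary
depends on `X` only through the spectrum of `X`. -/
theorem lintegral_sortedEigenvalues_restriction {Ω : Type*} [MeasurableSpace Ω] {μ : Measure Ω}
    [IsProbabilityMeasure μ] {n : ℕ} {X : Ω → Matrix (Fin (n + 1)) (Fin (n + 1)) ℂ}
    (hXm : Measurable X) (hX : ∀ ω, (X ω).IsHermitian)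
    {U : Ω → Matrix.unitaryGroup (Fin (n + 1)) ℂ} (hUm : Measurable U)
    [(μ.map U).IsMulLeftInvariant] (hXU : IndepFun X U μ) (i : Fin (n + 1))
    {ψ : (Fin n → ℝ) → ENNReal} (hψ : Measurable ψ) :
    ∫⁻ ω, ψ (sortedEigenvalues (restriction i (X ω) (U ω))) ∂μ
      = ∫⁻ ω, ∫⁻ u, ψ (secularRoots (sortedEigenvalues (X ω))
          fun k => Complex.normSq (u.1 i k)) ∂(μ.map U) ∂μ := by
  have : IsProbabilityMeasure (μ.map U) := Measure.isProbabilityMeasure_map hUm.aemeasurable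
  have hF : Measurable fun p : Matrix (Fin (n + 1)) (Fin (n + 1)) ℂ ×
      Matrix.unitaryGroup (Fin (n + 1)) ℂ => ψ (sortedEigenvalues (restriction i p.1 p.2)) :=
    hψ.comp ((measurable_sortedEigenvalues n).comp (measurable_restriction i))
  have h1 := hXU.map_prod_eq_prod_map_map hXm.aemeasurable hUm.aemeasurable
  have h2 := lintegral_map (μ := μ) hF (hXm.prodMk hUm)
  rw [h1, lintegral_prod _ hF.aemeasurable, lintegral_map hF.lintegral_prod_right' hXm] at h2
  rw [← h2]
  refine lintegral_congr fun ω => ?_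
  obtain ⟨V, hV⟩ := sortedEigenvalues_restriction i (hX ω)
  simp only [hV]
  have hm : Measurable fun u : Matrix.unitaryGroup (Fin (n + 1)) ℂ =>
      ψ (secularRoots (sortedEigenvalues (X ω)) fun k => Complex.normSq (u.1 i k)) :=
    hψ.comp (measurable_secularRoots.comp (measurable_const.prodMk (measurable_normSq_row i)))
  exact lintegral_mul_right_eq_self_of_isProbabilityMeasure (μ.map U) hm V

theorem measurable_lintegral_secularRoots {n : ℕ}
    (H : Measure (Matrix.unitaryGroup (Fin (n + 1)) ℂ)) [SFinite H] (i : Fin (n + 1))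
    {ψ : (Fin n → ℝ) → ENNReal} (hψ : Measurable ψ) :
    Measurable fun x : Fin (n + 1) → ℝ =>
      ∫⁻ u, ψ (secularRoots x fun k => Complex.normSq (u.1 i k)) ∂H := by
  apply Measurable.lintegral_prod_right' (f := fun p : (Fin (n + 1) → ℝ) ×
    Matrix.unitaryGroup (Fin (n + 1)) ℂ => ψ (secularRoots p.1 fun k => Complex.normSq (p.2.1 i k)))
  exact hψ.comp (measurable_secularRoots.comp (measurable_fst.prodMk
    ((measurable_normSq_row i).comp measurable_snd)))

/-! ### Ordered and unordered eigenvalues -/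


/-- The open Weyl chamber of strictly increasing vectors. -/
def chamber (n : ℕ) : Set (Fin n → ℝ) := {x | StrictMono x}

theorem mem_chamber {n : ℕ} {x : Fin n → ℝ} : x ∈ chamber n ↔ StrictMono x := by simp [chamber]

theorem measurableSet_chamber (n : ℕ) : MeasurableSet (chamber n) := by
  have : chamber n = ⋂ (i) (j) (_ : i < j), {y | y i < y j} := by
    ext y; simp [mem_chamber, StrictMono]
  rw [this]
  exact MeasurableSet.iInter fun i => MeasurableSet.iInter fun j => MeasurableSet.iInter fun _ =>
    measurableSet_lt (measurable_pi_apply i) (measurable_pi_apply j)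

theorem ae_injective (n : ℕ) : ∀ᵐ x : Fin n → ℝ, Function.Injective x := by
  have h : ∀ i j : Fin n, i ≠ j → ∀ᵐ x : Fin n → ℝ, x i ≠ x j := by
    intro i j hij
    have h0 := Measure.addHaar_submodule (volume : Measure (Fin n → ℝ))
      (LinearMap.ker ((LinearMap.proj i : (Fin n → ℝ) →ₗ[ℝ] ℝ) - LinearMap.proj j)) (by
        intro h
        have h1 : (Pi.single i 1 : Fin n → ℝ) ∈ LinearMap.ker
          ((LinearMap.proj i : (Fin n → ℝ) →ₗ[ℝ] ℝ) - LinearMap.proj j) := by rw [h]; trivial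
        simp [hij.symm] at h1)
    rw [ae_iff]
    convert! h0 using 2
    ext x
    simp [sub_eq_zero]
  have h' : ∀ᵐ x : Fin n → ℝ, ∀ i j, i ≠ j → x i ≠ x j := by
    rw [ae_all_iff]; intro i
    rw [ae_all_iff]; intro j
    by_cases hij : i = j
    · simp [hij]
    · filter_upwards [h i j hij] with x hx _ using hx
  filter_upwards [h'] with x hx i j hij
  by_contra hne
  exact hx i j hne hij

theorem perm_eq_of_strictMono_comp {n : ℕ} {x : Fin n → ℝ} {σ τ : Equiv.Perm (Fin n)}
    (hσ : StrictMono (x ∘ σ)) (hτ : StrictMono (x ∘ τ)) : σ = τ := by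
  have hx : Function.Injective x := by
    have := hσ.injective.comp σ.symm.injective
    simpa [Function.comp_def] using this
  have h := Tuple.unique_monotone hσ.monotone hτ.monotone
  ext1 i
  exact hx (congrFun h i)

/-- A vector with distinct entries lies in exactly one chamber. -/
theorem exists_strictMono_comp {n : ℕ} {x : Fin n → ℝ} (hx : Function.Injective x) :
    ∃ σ : Equiv.Perm (Fin n), StrictMono (x ∘ σ) :=
  ⟨Tuple.sort x, (Tuple.monotone_sort x).strictMono_of_injective (hx.comp (Equiv.injective _))⟩

theorem lintegral_comp_perm {n : ℕ} (σ : Equiv.Perm (Fin n)) (h : (Fin n → ℝ) → ENNReal) :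
    ∫⁻ x, h (x ∘ σ) = ∫⁻ x, h x := by
  have hmp := volume_measurePreserving_piCongrLeft (fun _ : Fin n => ℝ) σ.symm
  have h1 := hmp.lintegral_comp_emb
    (MeasurableEquiv.piCongrLeft (fun _ : Fin n => ℝ) σ.symm).measurableEmbedding h
  rw [← h1]
  refine lintegral_congr fun x => ?_
  congr 1
  funext i
  have := Equiv.piCongrLeft_apply_apply (fun _ : Fin n => ℝ) σ.symm x (σ i)
  rw [Equiv.symm_apply_apply] at this
  exact this.symm

/-- Lebesgue measure is the sum over all chambers of its restrictions. -/
theorem sum_lintegral_chamber_comp_perm {n : ℕ} {h : (Fin n → ℝ) → ENNReal} (hh : Measurable h) :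
    ∑ σ : Equiv.Perm (Fin n), ∫⁻ y in chamber n, h (y ∘ σ) = ∫⁻ y, h y := by
  have h1 : ∀ σ : Equiv.Perm (Fin n), ∫⁻ y in chamber n, h (y ∘ σ)
      = ∫⁻ y, (chamber n).indicator 1 (y ∘ σ.symm) * h y := by
    intro σ
    rw [← lintegral_indicator (measurableSet_chamber n),
      ← lintegral_comp_perm σ fun y => (chamber n).indicator 1 (y ∘ σ.symm) * h y]
    refine lintegral_congr fun y => ?_
    have h2 : (y ∘ σ) ∘ σ.symm = y := by funext i; simp
    rw [h2]
    by_cases hy : y ∈ chamber n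
    · simp [hy]
    · simp [hy]
  have hind : ∀ σ : Equiv.Perm (Fin n), Measurable fun y : Fin n → ℝ =>
      ((chamber n).indicator 1 (y ∘ σ.symm) : ENNReal) := by
    intro σ
    refine (measurable_one.indicator (measurableSet_chamber n)).comp ?_
    exact measurable_pi_iff.mpr fun i => measurable_pi_apply _
  simp only [h1]
  have hprod : ∀ σ : Equiv.Perm (Fin n), Measurable fun y : Fin n → ℝ =>
      ((chamber n).indicator 1 (y ∘ σ.symm) : ENNReal) * h y := fun σ => (hind σ).mul hh
  rw [← lintegral_finsetSum _ fun σ _ => hprod σ]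
  refine lintegral_congr_ae ?_
  filter_upwards [ae_injective n] with y hy
  obtain ⟨τ, hτ⟩ := exists_strictMono_comp hy
  rw [Finset.sum_eq_single τ.symm]
  · rw [Set.indicator_of_mem (by rw [Equiv.symm_symm]; exact mem_chamber.mpr hτ)]
    simp
  · intro σ _ hσ
    rw [Set.indicator_of_notMem, zero_mul]
    intro h3
    apply hσ
    have := perm_eq_of_strictMono_comp (mem_chamber.mp h3) hτ
    rw [← this, Equiv.symm_symm]
  · simp

theorem measurable_comp_perm {n : ℕ} (σ : Equiv.Perm (Fin n)) :
    Measurable fun x : Fin n → ℝ => x ∘ σ :=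
  measurable_pi_iff.mpr fun i => measurable_pi_apply (σ i)

theorem unorderedEigenvalueLaw_eq {Ω : Type*} [MeasurableSpace Ω] (μ : Measure Ω) {n : ℕ}
    (A : Ω → Matrix (Fin n) (Fin n) ℂ) (hA : ∀ ω, (A ω).IsHermitian) :
    unorderedEigenvalueLaw μ A hA = (n.factorial : ENNReal)⁻¹ •
      ∑ σ : Equiv.Perm (Fin n), μ.map fun ω => sortedEigenvalues (A ω) ∘ σ := by
  obtain ⟨ρ, hρ⟩ := exists_perm_eigenvalues n
  rw [unorderedEigenvalueLaw, ← Equiv.sum_comp (Equiv.mulLeft ρ)]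
  congr 1
  refine Finset.sum_congr rfl fun σ _ => ?_
  congr 1
  funext ω
  rw [(hρ (A ω) (hA ω)).2]
  rfl

theorem lintegral_unorderedEigenvalueLaw {Ω : Type*} [MeasurableSpace Ω] (μ : Measure Ω) {n : ℕ}
    {A : Ω → Matrix (Fin n) (Fin n) ℂ} (hAm : Measurable A) (hA : ∀ ω, (A ω).IsHermitian)
    {G : (Fin n → ℝ) → ENNReal} (hG : Measurable G) :
    ∫⁻ x, G x ∂(unorderedEigenvalueLaw μ A hA) = (n.factorial : ENNReal)⁻¹ *
      ∑ σ : Equiv.Perm (Fin n), ∫⁻ ω, G (sortedEigenvalues (A ω) ∘ σ) ∂μ := by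
  rw [unorderedEigenvalueLaw_eq, lintegral_smul_measure, lintegral_finsetSum_measure, smul_eq_mul]
  congr 1
  refine Finset.sum_congr rfl fun σ _ => ?_
  exact lintegral_map hG ((measurable_comp_perm σ).comp
    ((measurable_sortedEigenvalues n).comp hAm))

theorem ae_strictMono_sortedEigenvalues {Ω : Type*} [MeasurableSpace Ω] {μ : Measure Ω} {n : ℕ}
    {A : Ω → Matrix (Fin n) (Fin n) ℂ} (hAm : Measurable A) (hA : ∀ ω, (A ω).IsHermitian)
    {p : (Fin n → ℝ) → ENNReal}
    (hlaw : unorderedEigenvalueLaw μ A hA = volume.withDensity p) :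
    ∀ᵐ ω ∂μ, StrictMono (sortedEigenvalues (A ω)) := by
  have h1 : ∀ᵐ x ∂(unorderedEigenvalueLaw μ A hA), Function.Injective x := by
    rw [hlaw]
    exact withDensity_absolutelyContinuous _ _ (ae_injective n)
  have hm : Measurable fun ω => sortedEigenvalues (A ω) :=
    (measurable_sortedEigenvalues n).comp hAm
  have h2 : ∀ᵐ x ∂(μ.map fun ω => sortedEigenvalues (A ω)), Function.Injective x := by
    have h3 : (μ.map fun ω => sortedEigenvalues (A ω)) ≤
        ∑ σ : Equiv.Perm (Fin n), μ.map fun ω => sortedEigenvalues (A ω) ∘ σ :=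
      Finset.single_le_sum (f := fun σ : Equiv.Perm (Fin n) =>
        μ.map fun ω => sortedEigenvalues (A ω) ∘ σ) (fun σ _ => Measure.zero_le _)
        (Finset.mem_univ (1 : Equiv.Perm (Fin n)))
    rw [unorderedEigenvalueLaw_eq, ae_iff, Measure.smul_apply, smul_eq_mul, mul_eq_zero] at h1
    rw [ae_iff]
    rcases h1 with h1 | h1
    · simp at h1
    · exact le_antisymm ((h3 _).trans_eq h1) zero_le
  filter_upwards [ae_of_ae_map hm.aemeasurable h2] with ω hω
  exact (monotone_sortedEigenvalues (hA ω)).strictMono_of_injective hω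

/-- If the unordered eigenvalues have density `p`, then the increasingly ordered eigenvalues have
density `n! p` on the chamber. -/
theorem lintegral_sortedEigenvalues_of_law {Ω : Type*} [MeasurableSpace Ω] {μ : Measure Ω} {n : ℕ}
    {A : Ω → Matrix (Fin n) (Fin n) ℂ} (hAm : Measurable A) (hA : ∀ ω, (A ω).IsHermitian)
    {p : (Fin n → ℝ) → ENNReal} (hp : AEMeasurable p)
    (hlaw : unorderedEigenvalueLaw μ A hA = volume.withDensity p)
    {G : (Fin n → ℝ) → ENNReal} (hG : Measurable G) :
    ∫⁻ ω, G (sortedEigenvalues (A ω)) ∂μ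
      = n.factorial * ∫⁻ x in chamber n, p x * G x := by
  have hG' : Measurable ((chamber n).indicator G) := hG.indicator (measurableSet_chamber n)
  have h1 := lintegral_unorderedEigenvalueLaw μ hAm hA hG'
  rw [hlaw, lintegral_withDensity_eq_lintegral_mul₀ hp hG'.aemeasurable,
    Finset.sum_eq_single (1 : Equiv.Perm (Fin n))] at h1
  · have h2 : ∫⁻ x, (p * (chamber n).indicator G) x = ∫⁻ x in chamber n, p x * G x := by
      rw [← lintegral_indicator (measurableSet_chamber n)]
      refine lintegral_congr fun x => ?_
      by_cases hx : x ∈ chamber n <;> simp [hx]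
    have h3 : ∫⁻ ω, (chamber n).indicator G (sortedEigenvalues (A ω) ∘ (1 : Equiv.Perm (Fin n))) ∂μ
        = ∫⁻ ω, G (sortedEigenvalues (A ω)) ∂μ := by
      refine lintegral_congr_ae ?_
      filter_upwards [ae_strictMono_sortedEigenvalues hAm hA hlaw] with ω hω
      exact Set.indicator_of_mem (mem_chamber.mpr hω) _
    rw [h2, h3] at h1
    rw [h1, ← mul_assoc, ENNReal.mul_inv_cancel (by simp [Nat.factorial_ne_zero])
      (ENNReal.natCast_ne_top _), one_mul]
  · intro σ _ hσ
    rw [lintegral_congr_ae (g := 0), Pi.zero_def, lintegral_zero]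
    filter_upwards [ae_strictMono_sortedEigenvalues hAm hA hlaw] with ω hω
    rw [Set.indicator_of_notMem, Pi.zero_apply]
    intro h
    exact hσ (perm_eq_of_strictMono_comp (mem_chamber.mp h) (τ := 1) hω)
  · simp

/-- Conversely, a density of the increasingly ordered eigenvalues on the chamber determines, by
symmetrization, the density of the unordered eigenvalues. -/
theorem unorderedEigenvalueLaw_eq_withDensity {Ω : Type*} [MeasurableSpace Ω] {μ : Measure Ω}
    {n : ℕ} {A : Ω → Matrix (Fin n) (Fin n) ℂ} (hAm : Measurable A)
    (hA : ∀ ω, (A ω).IsHermitian) {D : (Fin n → ℝ) → ENNReal} (hD : Measurable D)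
    (hsymm : ∀ (σ : Equiv.Perm (Fin n)) (y : Fin n → ℝ), D (y ∘ σ) = D y) {c : ENNReal}
    (h : ∀ ψ : (Fin n → ℝ) → ENNReal, Measurable ψ →
      ∫⁻ ω, ψ (sortedEigenvalues (A ω)) ∂μ = c * ∫⁻ y in chamber n, D y * ψ y) :
    unorderedEigenvalueLaw μ A hA
      = volume.withDensity fun y => (n.factorial : ENNReal)⁻¹ * c * D y := by
  ext s hs
  have hind : Measurable (s.indicator (1 : (Fin n → ℝ) → ENNReal)) := measurable_one.indicator hs
  rw [withDensity_apply _ hs, lintegral_const_mul _ hD, ← lintegral_indicator_one hs,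
    lintegral_unorderedEigenvalueLaw μ hAm hA hind, mul_assoc]
  congr 1
  have h1 : ∀ σ : Equiv.Perm (Fin n),
      ∫⁻ ω, s.indicator 1 (sortedEigenvalues (A ω) ∘ σ) ∂μ
        = c * ∫⁻ y in chamber n, D (y ∘ σ) * s.indicator 1 (y ∘ σ) := by
    intro σ
    rw [h (fun y => s.indicator 1 (y ∘ σ)) (hind.comp (measurable_comp_perm σ))]
    simp only [hsymm]
  simp only [h1]
  rw [← Finset.mul_sum,
    sum_lintegral_chamber_comp_perm (h := fun y => D y * s.indicator 1 y) (hD.mul hind),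
    ← lintegral_indicator hs]
  congr 1
  refine lintegral_congr fun y => ?_
  by_cases hy : y ∈ s <;> simp [hy]

/-! ### Integration over the interlacing box -/


theorem aemeasurable_det_of_integrable {N : ℕ} {f : Fin N → ℝ → ℝ} (hf : ∀ k, Integrable (f k)) :
    AEMeasurable fun x : Fin N → ℝ => (Matrix.of fun j k => f k (x j)).det := by
  simp only [Matrix.det_apply', Matrix.of_apply]
  refine Finset.aemeasurable_fun_sum _ fun σ _ => ?_
  refine AEMeasurable.const_mul (Finset.aemeasurable_fun_prod _ fun i _ => ?_) _
  exact (hf i).aemeasurable.comp_quasiMeasurePreserving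
    (Measure.quasiMeasurePreserving_eval (fun _ : Fin N => (volume : Measure ℝ)) (σ i))

theorem aemeasurable_ensembleDensity {N : ℕ} {f : Fin N → ℝ → ℝ} (hf : ∀ k, Integrable (f k))
    (Z : ℝ) : AEMeasurable (ensembleDensity f Z) := by
  unfold ensembleDensity
  exact (measurable_vandermondeProd.aemeasurable.const_mul _).mul (aemeasurable_det_of_integrable hf)

theorem integrableOn_det_box {N : ℕ} {f : Fin N → ℝ → ℝ} (hf : ∀ k, Integrable (f k))
    (J : Fin N → Set ℝ) :
    IntegrableOn (fun x : Fin N → ℝ => (Matrix.of fun j k => f k (x j)).det)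
      (Set.univ.pi J) := by
  have h1 : ∀ x : Fin N → ℝ, (Matrix.of fun j k => f k (x j)).det
      = ∑ σ : Equiv.Perm (Fin N), (Equiv.Perm.sign σ : ℝ) * ∏ j, f (σ j) (x j) := by
    intro x
    rw [← Matrix.det_transpose, Matrix.det_apply']
    rfl
  simp only [h1]
  rw [IntegrableOn, volume_pi, Measure.restrict_pi_pi]
  refine integrable_finsetSum _ fun σ _ => Integrable.const_mul ?_ _
  exact Integrable.fintype_prod fun j => (hf (σ j)).restrict

/-- Andréief's identity for a box: the integral of a determinant over a product set. -/
theorem setIntegral_det_box {N : ℕ} {f : Fin N → ℝ → ℝ} (hf : ∀ k, Integrable (f k))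
    (J : Fin N → Set ℝ) :
    ∫ x in Set.univ.pi J, (Matrix.of fun j k => f k (x j)).det
      = (Matrix.of fun j k => ∫ t in J j, f k t).det := by
  have h1 : ∀ M : Fin N → Fin N → ℝ, (Matrix.of M).det
      = ∑ σ : Equiv.Perm (Fin N), (Equiv.Perm.sign σ : ℝ) * ∏ j, M j (σ j) := by
    intro M
    rw [← Matrix.det_transpose, Matrix.det_apply']
    rfl
  simp only [h1]
  rw [volume_pi, Measure.restrict_pi_pi, integral_finsetSum]
  · refine Finset.sum_congr rfl fun σ _ => ?_
    rw [integral_const_mul]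
    congr 1
    exact integral_fintype_prod_eq_prod fun j => f (σ j)
  · refine fun σ _ => Integrable.const_mul ?_ _
    exact Integrable.fintype_prod fun j => (hf (σ j)).restrict

/-- The `k`-th of the `n + 1` consecutive open intervals into which the points `y_l` cut the line.
The conditions are vacuous at the two ends. -/
def cell {n : ℕ} (y : Fin n → ℝ) (k : Fin (n + 1)) : Set ℝ :=
  {t | (∀ l : Fin n, l.succ = k → y l < t) ∧ ∀ l : Fin n, l.castSucc = k → t < y l}

/-- The half-line `(-∞, y_k]`, or the whole line when `k` is the last index. -/
def lowerCell {n : ℕ} (y : Fin n → ℝ) (k : Fin (n + 1)) : Set ℝ :=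
  {t | ∀ l : Fin n, l.castSucc = k → t ≤ y l}

theorem lowerCell_castSucc {n : ℕ} (y : Fin n → ℝ) (j : Fin n) :
    lowerCell y j.castSucc = Set.Iic (y j) := by
  ext t; simp [lowerCell]

theorem lowerCell_last {n : ℕ} (y : Fin n → ℝ) : lowerCell y (Fin.last n) = Set.univ := by
  ext t; simp [lowerCell, Fin.castSucc_ne_last]

theorem measurableSet_lowerCell {n : ℕ} (y : Fin n → ℝ) (k : Fin (n + 1)) :
    MeasurableSet (lowerCell y k) := by
  refine Fin.lastCases ?_ (fun j => ?_) k
  · rw [lowerCell_last]; exact MeasurableSet.univ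
  · rw [lowerCell_castSucc]; exact measurableSet_Iic

theorem setOf_mem_interlacing {n : ℕ} (y : Fin n → ℝ) :
    {x : Fin (n + 1) → ℝ | y ∈ interlacing x} = Set.univ.pi (cell y) := by
  ext x
  simp only [Set.mem_ofPred_eq, mem_interlacing, Set.mem_univ_pi, cell]
  constructor
  · rintro h k
    exact ⟨fun l hl => hl ▸ (h l).2, fun l hl => hl ▸ (h l).1⟩
  · rintro h l
    exact ⟨(h _).2 l rfl, (h _).1 l rfl⟩

theorem ae_notMem_range {n : ℕ} (y : Fin n → ℝ) : ∀ᵐ t : ℝ, t ∉ Set.range y := by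
  rw [ae_iff]
  have : {t | ¬ t ∉ Set.range y} = Set.range y := by ext; simp
  rw [this]
  exact (Set.finite_range y).measure_zero _

theorem cell_zero_ae_eq {n : ℕ} (y : Fin n → ℝ) : cell y 0 =ᵐ[volume] lowerCell y 0 := by
  rw [Filter.eventuallyEq_set]
  filter_upwards [ae_notMem_range y] with t ht
  simp only [cell, lowerCell, Set.mem_ofPred_eq, Fin.succ_ne_zero, false_imp_iff, implies_true,
    true_and]
  exact forall₂_congr fun l _ => ⟨le_of_lt, fun h => lt_of_le_of_ne h fun h' => ht ⟨l, h'.symm⟩⟩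

theorem cell_succ_ae_eq {n : ℕ} {y : Fin n → ℝ} (i : Fin n) :
    cell y i.succ =ᵐ[volume] (lowerCell y i.succ \ lowerCell y i.castSucc : Set ℝ) := by
  rw [Filter.eventuallyEq_set]
  filter_upwards [ae_notMem_range y] with t ht
  rw [lowerCell_castSucc, Set.mem_sdiff, Set.mem_Iic, not_le, and_comm]
  simp only [cell, lowerCell, Set.mem_ofPred_eq, Fin.succ_inj, forall_eq]
  refine and_congr_right fun _ => ?_
  exact forall₂_congr fun l _ => ⟨le_of_lt, fun h => lt_of_le_of_ne h fun h' => ht ⟨l, h'.symm⟩⟩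

theorem lowerCell_castSucc_subset {n : ℕ} {y : Fin n → ℝ} (hy : Monotone y) (i : Fin n) :
    lowerCell y i.castSucc ⊆ lowerCell y i.succ := by
  intro t ht
  rw [lowerCell_castSucc, Set.mem_Iic] at ht
  simp only [lowerCell, Set.mem_ofPred_eq]
  intro l hl
  refine ht.trans (hy ?_)
  have := congrArg Fin.val hl
  rw [Fin.val_castSucc, Fin.val_succ] at this
  rw [Fin.le_def]
  omega

/-- Row `j < n` holds the integrals `∫_{-∞}^{y_j} f_k`, and the last row the integrals `∫ f_k`. -/
noncomputable def cumulativeMatrix {n : ℕ} (f : Fin (n + 1) → ℝ → ℝ) (y : Fin n → ℝ) :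
    Matrix (Fin (n + 1)) (Fin (n + 1)) ℝ :=
  Matrix.of fun k m => ∫ t in lowerCell y k, f m t

theorem det_cell_eq_det_cumulativeMatrix {n : ℕ} {f : Fin (n + 1) → ℝ → ℝ}
    (hf : ∀ k, Integrable (f k)) {y : Fin n → ℝ} (hy : Monotone y) :
    (Matrix.of fun j k => ∫ t in cell y j, f k t).det = (cumulativeMatrix f y).det := by
  symm
  refine Matrix.det_eq_of_forall_row_eq_smul_add_pred (fun _ => 1) (fun j => ?_) fun i j => ?_
  · exact (setIntegral_congr_set (cell_zero_ae_eq y)).symm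
  · simp only [cumulativeMatrix, Matrix.of_apply, one_mul]
    rw [setIntegral_congr_set (cell_succ_ae_eq i),
      setIntegral_sdiff (measurableSet_lowerCell _ _) (hf j).integrableOn
        (lowerCell_castSucc_subset hy i), sub_add_cancel]

theorem measurableSet_interlacing_prod (n : ℕ) :
    MeasurableSet {p : (Fin (n + 1) → ℝ) × (Fin n → ℝ) | p.2 ∈ interlacing p.1} := by
  have : {p : (Fin (n + 1) → ℝ) × (Fin n → ℝ) | p.2 ∈ interlacing p.1}
      = ⋂ l, ({p | p.1 l.castSucc < p.2 l} ∩ {p | p.2 l < p.1 l.succ}) := by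
    ext p; simp [mem_interlacing]
  rw [this]
  exact MeasurableSet.iInter fun l => (measurableSet_lt (by fun_prop) (by fun_prop)).inter
    (measurableSet_lt (by fun_prop) (by fun_prop))

/-- The factor `(1 / Z) det [f_k(x_j)]` of the density, which is nonnegative on the chamber. -/
noncomputable def scaledDet {N : ℕ} (f : Fin N → ℝ → ℝ) (Z : ℝ) (x : Fin N → ℝ) : ℝ :=
  1 / Z * (Matrix.of fun j k => f k (x j)).det

theorem scaledDet_nonneg {N : ℕ} {f : Fin N → ℝ → ℝ} {Z : ℝ}
    (h : ∀ x, 0 ≤ ensembleDensity f Z x) {x : Fin N → ℝ} (hx : StrictMono x) :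
    0 ≤ scaledDet f Z x := by
  have h1 : ensembleDensity f Z x = scaledDet f Z x * vandermondeProd x := by
    rw [ensembleDensity, scaledDet]; ring
  exact nonneg_of_mul_nonneg_left (h1 ▸ h x) (vandermondeProd_pos hx)

theorem setLIntegral_scaledDet {n : ℕ} {f : Fin (n + 1) → ℝ → ℝ} (hf : ∀ k, Integrable (f k))
    {Z : ℝ} (h : ∀ x, 0 ≤ ensembleDensity f Z x) {y : Fin n → ℝ} (hy : Monotone y) :
    ∫⁻ x in {x : Fin (n + 1) → ℝ | y ∈ interlacing x}, ENNReal.ofReal (scaledDet f Z x)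
      = ENNReal.ofReal (1 / Z * (cumulativeMatrix f y).det) := by
  have hms : MeasurableSet {x : Fin (n + 1) → ℝ | y ∈ interlacing x} :=
    measurable_prodMk_right (measurableSet_interlacing_prod n)
  have hnn : 0 ≤ᵐ[volume.restrict {x : Fin (n + 1) → ℝ | y ∈ interlacing x}] scaledDet f Z := by
    filter_upwards [ae_restrict_mem hms] with x hx
    exact scaledDet_nonneg h (strictMono_left_of_interlacing (by simpa using hx))
  have hint : IntegrableOn (scaledDet f Z) {x : Fin (n + 1) → ℝ | y ∈ interlacing x} := by
    rw [setOf_mem_interlacing]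
    exact (integrableOn_det_box hf (cell y)).const_mul (1 / Z)
  rw [← ofReal_integral_eq_lintegral_ofReal hint hnn, setOf_mem_interlacing]
  unfold scaledDet
  rw [integral_const_mul, setIntegral_det_box hf, det_cell_eq_det_cumulativeMatrix hf hy]

theorem cumulativeMatrix_det_nonneg {n : ℕ} {f : Fin (n + 1) → ℝ → ℝ} (hf : ∀ k, Integrable (f k))
    {Z : ℝ} (h : ∀ x, 0 ≤ ensembleDensity f Z x) {y : Fin n → ℝ} (hy : Monotone y) :
    0 ≤ 1 / Z * (cumulativeMatrix f y).det := by
  have hms : MeasurableSet {x : Fin (n + 1) → ℝ | y ∈ interlacing x} :=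
    measurable_prodMk_right (measurableSet_interlacing_prod n)
  rw [← det_cell_eq_det_cumulativeMatrix hf hy, ← setIntegral_det_box hf, ← integral_const_mul,
    ← setOf_mem_interlacing]
  refine setIntegral_nonneg hms fun x hx => ?_
  exact scaledDet_nonneg h (strictMono_left_of_interlacing (by simpa using hx))

/-- Averaging the conditional law of the interlacing vector over the chamber. By Tonelli's theorem
the inner integral runs over a box, where it is a determinant of integrals. -/
theorem lintegral_chamber_interlacing {n : ℕ} {f : Fin (n + 1) → ℝ → ℝ}
    (hf : ∀ k, Integrable (f k)) {Z : ℝ} (h : ∀ x, 0 ≤ ensembleDensity f Z x)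
    {ψ : (Fin n → ℝ) → ENNReal} (hψ : Measurable ψ) :
    ∫⁻ x in chamber (n + 1), ENNReal.ofReal (ensembleDensity f Z x) *
      ∫⁻ y in interlacing x, ENNReal.ofReal (|vandermondeProd y| / |vandermondeProd x|) * ψ y
    = ∫⁻ y in chamber n, ENNReal.ofReal (vandermondeProd y *
        (1 / Z * (cumulativeMatrix f y).det)) * ψ y := by
  set T : Set ((Fin (n + 1) → ℝ) × (Fin n → ℝ)) := {p | p.2 ∈ interlacing p.1} with hT
  have hTm : MeasurableSet T := measurableSet_interlacing_prod n
  have hmemT : ∀ x y, (x, y) ∈ T ↔ y ∈ interlacing x := by intro x y; simp [hT]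
  have hφ : Measurable fun y : Fin n → ℝ => ENNReal.ofReal |vandermondeProd y| * ψ y :=
    measurable_vandermondeProd.abs.ennreal_ofReal.mul hψ
  set φ : (Fin n → ℝ) → ENNReal := fun y => ENNReal.ofReal |vandermondeProd y| * ψ y with hφ'
  have hsd : AEMeasurable fun x => ENNReal.ofReal (scaledDet f Z x) :=
    ((aemeasurable_det_of_integrable hf).const_mul (1 / Z)).ennreal_ofReal
  let F : (Fin (n + 1) → ℝ) → (Fin n → ℝ) → ENNReal := fun x y =>
    T.indicator 1 (x, y) * (ENNReal.ofReal (scaledDet f Z x) * φ y)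
  have hF : AEMeasurable (Function.uncurry F) ((volume : Measure (Fin (n + 1) → ℝ)).prod volume) := by
    refine (measurable_one.indicator hTm).aemeasurable.mul (AEMeasurable.mul ?_ ?_)
    · exact hsd.comp_fst
    · exact (hφ.comp measurable_snd).aemeasurable
  have hL : ∫⁻ x in chamber (n + 1), ENNReal.ofReal (ensembleDensity f Z x) *
      ∫⁻ y in interlacing x, ENNReal.ofReal (|vandermondeProd y| / |vandermondeProd x|) * ψ y
      = ∫⁻ x, ∫⁻ y, F x y := by
    rw [← lintegral_indicator (measurableSet_chamber _)]
    refine lintegral_congr fun x => ?_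
    by_cases hx : x ∈ chamber (n + 1)
    · have hx' := vandermondeProd_pos (mem_chamber.mp hx)
      have hm1 : Measurable fun y : Fin n → ℝ =>
          ENNReal.ofReal (|vandermondeProd y| / |vandermondeProd x|) * ψ y :=
        (measurable_vandermondeProd.abs.div_const _).ennreal_ofReal.mul hψ
      rw [Set.indicator_of_mem hx, ← lintegral_const_mul _ hm1,
        ← lintegral_indicator (measurableSet_interlacing x)]
      refine lintegral_congr fun y => ?_
      by_cases hy : y ∈ interlacing x
      · have h1 : ensembleDensity f Z x = scaledDet f Z x * vandermondeProd x := by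
          rw [ensembleDensity, scaledDet]; ring
        have h2 : ENNReal.ofReal (ensembleDensity f Z x) *
            ENNReal.ofReal (|vandermondeProd y| / |vandermondeProd x|)
            = ENNReal.ofReal (scaledDet f Z x) * ENNReal.ofReal |vandermondeProd y| := by
          rw [← ENNReal.ofReal_mul (h x), ← ENNReal.ofReal_mul
            (scaledDet_nonneg h (mem_chamber.mp hx)), h1, abs_of_pos hx']
          congr 1
          field_simp
        simp only [F]
        rw [Set.indicator_of_mem hy, Set.indicator_of_mem ((hmemT x y).mpr hy), ← mul_assoc, h2,
          hφ', Pi.one_apply, one_mul, mul_assoc]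
      · simp only [F]
        rw [Set.indicator_of_notMem hy, Set.indicator_of_notMem (fun h' => hy ((hmemT x y).mp h')),
          zero_mul]
    · rw [Set.indicator_of_notMem hx]
      have : ∀ y, F x y = 0 := by
        intro y
        simp only [F]
        rw [Set.indicator_of_notMem, zero_mul]
        intro h'
        exact hx (mem_chamber.mpr (strictMono_left_of_interlacing ((hmemT x y).mp h')))
      simp [this]
  rw [hL, lintegral_lintegral_swap hF, ← lintegral_indicator (measurableSet_chamber n)]
  refine lintegral_congr fun y => ?_
  by_cases hy : y ∈ chamber n
  · have hy' := vandermondeProd_pos (mem_chamber.mp hy)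
    have hms : MeasurableSet {x : Fin (n + 1) → ℝ | y ∈ interlacing x} :=
      measurable_prodMk_right (measurableSet_interlacing_prod n)
    have h3 : ∀ x, F x y = {x : Fin (n + 1) → ℝ | y ∈ interlacing x}.indicator
        (fun x => ENNReal.ofReal (scaledDet f Z x)) x * φ y := by
      intro x
      simp only [F]
      by_cases hxy : y ∈ interlacing x
      · rw [Set.indicator_of_mem ((hmemT x y).mpr hxy), Set.indicator_of_mem (by simpa using hxy),
          Pi.one_apply, one_mul]
      · rw [Set.indicator_of_notMem (fun h' => hxy ((hmemT x y).mp h')),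
          Set.indicator_of_notMem (by simpa using hxy), zero_mul, zero_mul]
    simp only [h3]
    rw [lintegral_mul_const'' _ (hsd.indicator hms), lintegral_indicator hms,
      setLIntegral_scaledDet hf h (mem_chamber.mp hy).monotone, Set.indicator_of_mem hy,
      ENNReal.ofReal_mul hy'.le]
    simp only [hφ', abs_of_pos hy']
    ring
  · rw [Set.indicator_of_notMem hy]
    have : ∀ x, F x y = 0 := by
      intro x
      simp only [F]
      rw [Set.indicator_of_notMem, zero_mul]
      intro h'
      exact hy (mem_chamber.mpr (strictMono_of_mem_interlacing ((hmemT x y).mp h')))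
    simp [this]

/-! ### The compressed ensemble -/


theorem cornerConst_ne_top (n : ℕ) : cornerConst n ≠ ⊤ := by
  refine ENNReal.mul_ne_top (ENNReal.inv_ne_top.mpr (volume_unitaryBall_ne_zero _)) ?_
  have h : ∫⁻ s in Set.Ioc (0 : ℝ) 1, ENNReal.ofReal (|s| ^ n) ≤ ∫⁻ s in Set.Ioc (0 : ℝ) 1, 1 := by
    refine setLIntegral_mono measurable_const fun s hs => ?_
    rw [ENNReal.ofReal_le_one, abs_of_pos hs.1]
    exact pow_le_one₀ hs.1.le hs.2
  refine (h.trans_lt ?_).ne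
  simp

/-- The law of the increasingly ordered eigenvalues of the compression. -/
theorem lintegral_sortedEigenvalues_restriction_of_law {Ω : Type*} [MeasurableSpace Ω]
    {μ : Measure Ω} [IsProbabilityMeasure μ] {n : ℕ} {f : Fin (n + 1) → ℝ → ℝ}
    {X : Ω → Matrix (Fin (n + 1)) (Fin (n + 1)) ℂ} (hXm : Measurable X)
    (hX : ∀ ω, (X ω).IsHermitian) (hf : ∀ k, Integrable (f k)) {Z : ℝ}
    (hnn : ∀ x, 0 ≤ ensembleDensity f Z x)
    (hlaw : unorderedEigenvalueLaw μ X hX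
      = volume.withDensity fun x => ENNReal.ofReal (ensembleDensity f Z x))
    {U : Ω → Matrix.unitaryGroup (Fin (n + 1)) ℂ} (hU : IsHaarUnitary μ U)
    (hXU : IndepFun X U μ) (i : Fin (n + 1)) {ψ : (Fin n → ℝ) → ENNReal} (hψ : Measurable ψ) :
    ∫⁻ ω, ψ (sortedEigenvalues (restriction i (X ω) (U ω))) ∂μ
      = ((n + 1).factorial * cornerConst n) * ∫⁻ y in chamber n,
        ENNReal.ofReal (vandermondeProd y * (1 / Z * (cumulativeMatrix f y).det)) * ψ y := by
  have : (μ.map U).IsHaarMeasure := hU.2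
  have : IsProbabilityMeasure (μ.map U) := Measure.isProbabilityMeasure_map hU.1.aemeasurable
  rw [lintegral_sortedEigenvalues_restriction hXm hX hU.1 hXU i hψ,
    lintegral_sortedEigenvalues_of_law hXm hX (aemeasurable_ensembleDensity hf Z).ennreal_ofReal
      hlaw (measurable_lintegral_secularRoots (μ.map U) i hψ),
    ← lintegral_chamber_interlacing hf hnn hψ, mul_assoc,
    ← lintegral_const_mul' _ _ (cornerConst_ne_top n)]
  congr 1
  refine setLIntegral_congr_fun (measurableSet_chamber _) fun x hx => ?_
  simp only [lintegral_haar_secularRoots (μ.map U) i (mem_chamber.mp hx) hψ]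
  ring

theorem continuous_setIntegral_Iic {F : ℝ → ℝ} (hF : Integrable F) :
    Continuous fun y => ∫ x in Set.Iic y, F x := by
  have h : (fun y => ∫ x in Set.Iic y, F x)
      = fun y => (∫ x in (0 : ℝ)..y, F x) + ∫ x in Set.Iic 0, F x := by
    funext y
    rw [← intervalIntegral.integral_Iic_sub_Iic hF.integrableOn hF.integrableOn, sub_add_cancel]
  rw [h]
  exact (intervalIntegral.continuous_primitive (fun a b => hF.intervalIntegrable) 0).add
    continuous_const

/-- The primitive at `y` of a function of zero integral is controlled by the mass of the function
outside `(-|y|, |y|)`. -/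
theorem enorm_setIntegral_Iic_le {F : ℝ → ℝ} (hF : Integrable F) (h0 : ∫ x, F x = 0) (y : ℝ) :
    ‖∫ x in Set.Iic y, F x‖ₑ ≤ ∫⁻ x in {x | |y| ≤ |x|}, ‖F x‖ₑ := by
  rcases le_or_gt 0 y with hy | hy
  · have h1 := integral_add_compl (measurableSet_Iic (a := y)) hF
    rw [h0, Set.compl_Iic] at h1
    rw [eq_neg_of_add_eq_zero_left h1, enorm_neg]
    refine (enorm_integral_le_lintegral_enorm _).trans (lintegral_mono_set fun x hx => ?_)
    rw [Set.mem_ofPred_eq, abs_of_nonneg hy]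
    exact (le_of_lt hx).trans (le_abs_self x)
  · refine (enorm_integral_le_lintegral_enorm _).trans (lintegral_mono_set fun x hx => ?_)
    rw [Set.mem_ofPred_eq, abs_of_neg hy, abs_of_neg (lt_of_le_of_lt hx hy)]
    exact neg_le_neg hx

theorem lintegral_enorm_pow_le (j : ℕ) (x : ℝ) :
    ∫⁻ y in {y : ℝ | |y| ≤ |x|}, ‖y ^ j‖ₑ ≤ 2 * ‖x ^ (j + 1)‖ₑ := by
  have hset : {y : ℝ | |y| ≤ |x|} = Set.Icc (-|x|) |x| := by
    ext y; simp [abs_le]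
  calc ∫⁻ y in {y : ℝ | |y| ≤ |x|}, ‖y ^ j‖ₑ ≤ ∫⁻ y in {y : ℝ | |y| ≤ |x|}, ‖x ^ j‖ₑ := by
        refine setLIntegral_mono measurable_const fun y hy => ?_
        rw [Set.mem_ofPred_eq] at hy
        rw [Real.enorm_eq_ofReal_abs, Real.enorm_eq_ofReal_abs, abs_pow, abs_pow]
        exact ENNReal.ofReal_le_ofReal (pow_le_pow_left₀ (abs_nonneg y) hy j)
    _ = 2 * ‖x ^ (j + 1)‖ₑ := by
        rw [setLIntegral_const, hset, Real.volume_Icc, pow_succ, enorm_mul,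
          Real.enorm_eq_ofReal_abs x, sub_neg_eq_add, ← two_mul, ENNReal.ofReal_mul zero_le_two,
          ENNReal.ofReal_ofNat]
        ring

theorem integrable_pow_mul_setIntegral_Iic {F : ℝ → ℝ} (hF : Integrable F) (h0 : ∫ x, F x = 0)
    {j : ℕ} (hj : Integrable fun x : ℝ => x ^ (j + 1) * F x) :
    Integrable fun y : ℝ => y ^ j * ∫ x in Set.Iic y, F x := by
  refine ⟨((continuous_pow j).mul (continuous_setIntegral_Iic hF)).aestronglyMeasurable, ?_⟩
  rw [hasFiniteIntegral_iff_enorm]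
  let T : Set (ℝ × ℝ) := {p | |p.1| ≤ |p.2|}
  have hT : MeasurableSet T := measurableSet_le (by fun_prop) (by fun_prop)
  let K : ℝ → ℝ → ENNReal := fun y x => T.indicator 1 (y, x) * (‖y ^ j‖ₑ * ‖F x‖ₑ)
  have hFm : AEMeasurable fun x => ‖F x‖ₑ := hF.aestronglyMeasurable.enorm
  have hK : AEMeasurable (Function.uncurry K) ((volume : Measure ℝ).prod volume) := by
    refine (measurable_one.indicator hT).aemeasurable.mul (AEMeasurable.mul ?_ hFm.comp_snd)
    exact Measurable.aemeasurable (by fun_prop)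
  have hm : ∀ a : ℝ, MeasurableSet {x : ℝ | |a| ≤ |x|} := fun a =>
    measurableSet_le measurable_const (by fun_prop)
  have hm' : ∀ a : ℝ, MeasurableSet {x : ℝ | |x| ≤ |a|} := fun a =>
    measurableSet_le (by fun_prop) measurable_const
  calc ∫⁻ y, ‖y ^ j * ∫ x in Set.Iic y, F x‖ₑ ≤ ∫⁻ y, ∫⁻ x, K y x := by
        refine lintegral_mono fun y => ?_
        have h1 : ∀ x, K y x = ‖y ^ j‖ₑ * {x : ℝ | |y| ≤ |x|}.indicator (fun x => ‖F x‖ₑ) x := by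
          intro x
          by_cases hx : |y| ≤ |x| <;> simp [K, T, hx]
        simp only [h1]
        rw [lintegral_const_mul' _ _ enorm_ne_top, lintegral_indicator (hm y), enorm_mul]
        gcongr
        exact enorm_setIntegral_Iic_le hF h0 y
    _ = ∫⁻ x, ∫⁻ y, K y x := lintegral_lintegral_swap hK
    _ ≤ ∫⁻ x, 2 * ‖x ^ (j + 1) * F x‖ₑ := by
        refine lintegral_mono fun x => ?_
        have h1 : ∀ y, K y x = {y : ℝ | |y| ≤ |x|}.indicator (fun y => ‖y ^ j‖ₑ) y * ‖F x‖ₑ := by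
          intro y
          by_cases hx : |y| ≤ |x| <;> simp [K, T, hx]
        simp only [h1]
        rw [lintegral_mul_const' _ _ enorm_ne_top, lintegral_indicator (hm' x), enorm_mul,
          ← mul_assoc]
        gcongr
        exact lintegral_enorm_pow_le j x
    _ < ⊤ := by
        rw [lintegral_const_mul' _ _ (by simp)]
        exact ENNReal.mul_lt_top (by simp) hj.hasFiniteIntegral

theorem det_cumulativeMatrix_eq_zero {n : ℕ} {f : Fin (n + 1) → ℝ → ℝ} (h : ∀ m, ∫ x, f m x = 0)
    (y : Fin n → ℝ) : (cumulativeMatrix f y).det = 0 := by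
  refine Matrix.det_eq_zero_of_row_eq_zero (Fin.last n) fun m => ?_
  rw [cumulativeMatrix, Matrix.of_apply, lowerCell_last, setIntegral_univ, h m]

theorem integrable_of_mem_span {N : ℕ} {f : Fin N → ℝ → ℝ} (hf : ∀ k, Integrable (f k))
    {h : ℝ → ℝ} (hh : h ∈ Submodule.span ℝ (Set.range f)) : Integrable h := by
  induction hh using Submodule.span_induction with
  | mem x hx => obtain ⟨k, rfl⟩ := hx; exact hf k
  | zero => exact integrable_zero _ _ _
  | add x y _ _ hx hy => exact hx.add hy
  | smul a x _ hx => exact hx.smul a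

theorem integrable_pow_mul_of_mem_span {N : ℕ} {f : Fin N → ℝ → ℝ} {j : ℕ}
    (hf : ∀ k, Integrable fun x : ℝ => x ^ j * f k x) {h : ℝ → ℝ}
    (hh : h ∈ Submodule.span ℝ (Set.range f)) : Integrable fun x : ℝ => x ^ j * h x := by
  induction hh using Submodule.span_induction with
  | mem x hx => obtain ⟨k, rfl⟩ := hx; exact hf k
  | zero => simp
  | add x y _ _ hx hy =>
    simp only [Pi.add_apply, mul_add]
    exact hx.add hy
  | smul a x _ hx =>
    simp only [Pi.smul_apply, smul_eq_mul, mul_left_comm _ a]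
    exact hx.const_mul a

theorem mem_zeroIntegralSpan {N : ℕ} {f : Fin N → ℝ → ℝ} {h : ℝ → ℝ} :
    h ∈ zeroIntegralSpan f ↔
      h ∈ Submodule.span ℝ (Set.range f) ∧ Integrable h ∧ ∫ x, h x = 0 := by
  rw [← SetLike.mem_coe]
  simp only [zeroIntegralSpan, Submodule.coe_set_mk, AddSubmonoid.coe_set_mk,
    AddSubsemigroup.coe_set_mk, Set.mem_ofPred_eq]

/-- The functions of zero integral form a hyperplane in the span as soon as one of the spanning
functions has a nonzero integral. -/
theorem nonempty_basis_zeroIntegralSpan {n : ℕ} {f : Fin (n + 1) → ℝ → ℝ}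
    (hli : LinearIndependent ℝ f) (hf : ∀ k, Integrable (f k)) {m : Fin (n + 1)}
    (hm : ∫ x, f m x ≠ 0) : Nonempty (Module.Basis (Fin n) ℝ (zeroIntegralSpan f)) := by
  let W := Submodule.span ℝ (Set.range f)
  have : FiniteDimensional ℝ W := FiniteDimensional.span_of_finite ℝ (Set.finite_range f)
  have hW : Module.finrank ℝ W = n + 1 := by
    simpa using finrank_span_eq_card hli
  let J : W →ₗ[ℝ] ℝ :=
    { toFun := fun h => ∫ x, (h : ℝ → ℝ) x
      map_add' := fun a b => integral_add (integrable_of_mem_span hf a.2)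
        (integrable_of_mem_span hf b.2)
      map_smul' := fun c a => integral_const_mul c _ }
  have hJ : J ≠ 0 := fun h => hm (LinearMap.congr_fun h ⟨f m, Submodule.subset_span ⟨m, rfl⟩⟩)
  have hrange : Module.finrank ℝ (LinearMap.range J) = 1 := by
    rw [LinearMap.range_eq_top.mpr (LinearMap.surjective hJ)]
    simp
  have hker : Module.finrank ℝ (LinearMap.ker J) = n := by
    have := LinearMap.finrank_range_add_finrank_ker J
    omega
  have hmap : zeroIntegralSpan f = (LinearMap.ker J).map W.subtype := by
    ext h
    rw [mem_zeroIntegralSpan, Submodule.mem_map]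
    constructor
    · rintro ⟨h1, _, h3⟩
      exact ⟨⟨h, h1⟩, h3, rfl⟩
    · rintro ⟨a, ha, rfl⟩
      exact ⟨a.2, integrable_of_mem_span hf a.2, ha⟩
  rw [hmap]
  have hfin : Module.finrank ℝ ((LinearMap.ker J).map W.subtype) = n := by
    rw [← hker]
    exact (Submodule.equivMapOfInjective _ W.injective_subtype _).finrank_eq.symm
  exact ⟨Module.finBasisOfFinrankEq ℝ _ hfin⟩

/-- Passing from `f` to a basis of the functions of zero integral, completed by one of the `f_m`,
turns the determinant of cumulative integrals into the determinant of the primitives. -/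
theorem exists_det_cumulativeMatrix_eq {n : ℕ} {f : Fin (n + 1) → ℝ → ℝ}
    (hf : ∀ k, Integrable (f k)) {m : Fin (n + 1)} (hm : ∫ x, f m x ≠ 0)
    (b : Module.Basis (Fin n) ℝ (zeroIntegralSpan f)) :
    ∃ κ : ℝ, κ ≠ 0 ∧ ∀ y : Fin n → ℝ, (cumulativeMatrix f y).det
      = κ * (Matrix.of fun j k => ∫ x in Set.Iic (y j), (b k : ℝ → ℝ) x).det := by
  have hb := fun k => mem_zeroIntegralSpan.mp (b k).2
  have hB : ∀ k, ∃ c : Fin (n + 1) → ℝ, ∑ l, c l • f l = (b k : ℝ → ℝ) := fun k =>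
    (Submodule.mem_span_range_iff_exists_fun ℝ).mp (hb k).1
  choose B hB using hB
  let M : Matrix (Fin (n + 1)) (Fin (n + 1)) ℝ := Matrix.of fun l k =>
    (Fin.snoc B (Pi.single m 1) : Fin (n + 1) → Fin (n + 1) → ℝ) k l
  let e : Fin (n + 1) → ℝ → ℝ := Fin.snoc (fun k => (b k : ℝ → ℝ)) (f m)
  have he : ∀ k, e k = ∑ l, M l k • f l := by
    refine Fin.lastCases ?_ fun k => ?_
    · simp [e, M, Pi.single_apply]
    · simp [e, M, hB]
  have hmul : ∀ y, cumulativeMatrix f y * M = cumulativeMatrix e y := by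
    intro y
    ext k j
    simp only [cumulativeMatrix, Matrix.mul_apply, Matrix.of_apply, he, Finset.sum_apply,
      Pi.smul_apply, smul_eq_mul]
    rw [integral_finsetSum _ fun l _ => ((hf l).const_mul _).integrableOn]
    refine Finset.sum_congr rfl fun l _ => ?_
    rw [integral_const_mul, mul_comm]
  have hlast : e (Fin.last n) = f m := by simp [e]
  have hcast : ∀ k : Fin n, e k.castSucc = (b k : ℝ → ℝ) := by intro k; simp [e]
  have hdet : ∀ y, (cumulativeMatrix e y).det
      = (∫ x, f m x) * (Matrix.of fun j k => ∫ x in Set.Iic (y j), (b k : ℝ → ℝ) x).det := by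
    intro y
    rw [Matrix.det_succ_row _ (Fin.last n), Fin.sum_univ_castSucc, Finset.sum_eq_zero, zero_add]
    · simp only [cumulativeMatrix, Matrix.of_apply, lowerCell_last, setIntegral_univ, hlast,
        Fin.succAbove_last, Even.neg_one_pow (Even.add_self _), one_mul]
      congr 2
      ext j k
      simp [lowerCell_castSucc, hcast]
    · intro k _
      simp [cumulativeMatrix, lowerCell_last, hcast, (hb k).2.2]
  have hM : M.det ≠ 0 := by
    intro h0
    obtain ⟨v, hv, hMv⟩ := Matrix.exists_mulVec_eq_zero_iff.mpr h0
    have h1 : ∑ k, v k • e k = 0 := by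
      have h2 : ∑ k, v k • e k = ∑ l, (M.mulVec v) l • f l := by
        simp only [he, Matrix.mulVec, dotProduct, Finset.smul_sum, Finset.sum_smul, smul_smul]
        rw [Finset.sum_comm]
        simp only [mul_comm]
      rw [h2, hMv]
      simp
    rw [Fin.sum_univ_castSucc, hlast] at h1
    simp only [hcast] at h1
    have h3 : v (Fin.last n) = 0 := by
      have h4 : ∫ x, ((∑ k : Fin n, v k.castSucc • (b k : ℝ → ℝ)) x + v (Fin.last n) * f m x) = 0 := by
        have : ∀ x, (∑ k : Fin n, v k.castSucc • (b k : ℝ → ℝ)) x + v (Fin.last n) * f m x = 0 :=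
          fun x => congrFun h1 x
        simp only [this, integral_zero]
      have h5 : ∑ k : Fin n, v k.castSucc • (b k : ℝ → ℝ) ∈ zeroIntegralSpan f :=
        Submodule.sum_mem _ fun k _ => Submodule.smul_mem _ _ (b k).2
      rw [mem_zeroIntegralSpan] at h5
      rw [integral_add h5.2.1 ((hf m).const_mul _), h5.2.2, zero_add, integral_const_mul] at h4
      exact (mul_eq_zero.mp h4).resolve_right hm
    rw [h3, zero_smul, add_zero] at h1
    have h6 : ∑ k : Fin n, v k.castSucc • b k = 0 := by
      apply Subtype.ext
      simpa using h1
    have h7 := Fintype.linearIndependent_iff.mp b.linearIndependent _ h6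
    apply hv
    funext k
    refine Fin.lastCases h3 (fun k => h7 k) k
  refine ⟨(∫ x, f m x) / M.det, div_ne_zero hm hM, fun y => ?_⟩
  have h8 : (cumulativeMatrix f y).det * M.det = (cumulativeMatrix e y).det := by
    rw [← Matrix.det_mul, hmul]
  rw [div_mul_eq_mul_div, ← hdet, ← h8, mul_div_cancel_right₀ _ hM]

theorem ensembleDensity_comp_perm {n : ℕ} (g : Fin n → ℝ → ℝ) (Z : ℝ) (σ : Equiv.Perm (Fin n))
    (y : Fin n → ℝ) : ensembleDensity g Z (y ∘ σ) = ensembleDensity g Z y := by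
  have h1 : vandermondeProd (y ∘ σ) = (Equiv.Perm.sign σ : ℝ) * vandermondeProd y := by
    rw [vandermondeProd_eq_det, vandermondeProd_eq_det, ← Matrix.det_permute]
    rfl
  have h2 : (Matrix.of fun j k => g k ((y ∘ σ) j)).det
      = (Equiv.Perm.sign σ : ℝ) * (Matrix.of fun j k => g k (y j)).det := by
    rw [← Matrix.det_permute]
    rfl
  have h3 : ((Equiv.Perm.sign σ : ℤ) : ℝ) * ((Equiv.Perm.sign σ : ℤ) : ℝ) = 1 := by
    rcases Int.units_eq_one_or (Equiv.Perm.sign σ) with h | h <;> simp [h]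
  rw [ensembleDensity, ensembleDensity, h1, h2]
  linear_combination (1 / Z * vandermondeProd y * (Matrix.of fun j k => g k (y j)).det) * h3

theorem ensembleDensity_nonneg_of_chamber {n : ℕ} {g : Fin n → ℝ → ℝ} {Z : ℝ}
    (h : ∀ y, StrictMono y → 0 ≤ ensembleDensity g Z y) (y : Fin n → ℝ) :
    0 ≤ ensembleDensity g Z y := by
  by_cases hy : Function.Injective y
  · obtain ⟨σ, hσ⟩ := exists_strictMono_comp hy
    rw [← ensembleDensity_comp_perm g Z σ]
    exact h _ hσ
  · have : vandermondeProd y = 0 := not_not.mp (mt vandermondeProd_ne_zero_iff.mp hy)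
    simp [ensembleDensity, this]

theorem ensembleDensity_eq_zero_of_not_linearIndependent {n : ℕ} {g : Fin n → ℝ → ℝ}
    (hg : ¬ LinearIndependent ℝ g) (Z : ℝ) (y : Fin n → ℝ) : ensembleDensity g Z y = 0 := by
  obtain ⟨c, hc, k, hk⟩ := Fintype.not_linearIndependent_iff.mp hg
  have : (Matrix.of fun j k => g k (y j)).det = 0 := by
    refine Matrix.exists_mulVec_eq_zero_iff.mp ⟨c, fun h => hk (congrFun h k), ?_⟩
    funext j
    have := congrFun hc (y j)
    simpa [Matrix.mulVec, dotProduct, mul_comm] using this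
  rw [ensembleDensity, this, mul_zero]

/-- A matrix whose increasingly ordered eigenvalues have, up to a constant factor, the density of a
determinantal expression on the chamber has eigenvalues forming a polynomial ensemble. Linear
independence is automatic, because the density of dependent functions vanishes. -/
theorem eigenvaluesArePolynomialEnsemble_of_sorted {Ω : Type*} [MeasurableSpace Ω] {μ : Measure Ω}
    [IsProbabilityMeasure μ] {n : ℕ} {A : Ω → Matrix (Fin n) (Fin n) ℂ} (hAm : Measurable A)
    (hA : ∀ ω, (A ω).IsHermitian) {g : Fin n → ℝ → ℝ} (hgm : ∀ k, Measurable (g k))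
    (hmom : ∀ j k : Fin n, Integrable fun x : ℝ => x ^ (j : ℕ) * g k x) {Z : ℝ} (hZ : Z ≠ 0)
    (hnn : ∀ y, StrictMono y → 0 ≤ ensembleDensity g Z y) {c : ENNReal} (hc : c ≠ ⊤)
    (h : ∀ ψ : (Fin n → ℝ) → ENNReal, Measurable ψ → ∫⁻ ω, ψ (sortedEigenvalues (A ω)) ∂μ
      = c * ∫⁻ y in chamber n, ENNReal.ofReal (ensembleDensity g Z y) * ψ y) :
    EigenvaluesArePolynomialEnsemble μ A hA g := by
  have hDm : Measurable fun y : Fin n → ℝ => ENNReal.ofReal (ensembleDensity g Z y) := by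
    have : Measurable fun y : Fin n → ℝ => (Matrix.of fun j k => g k (y j)).det := by
      simp only [Matrix.det_apply', Matrix.of_apply]
      fun_prop
    exact ((measurable_vandermondeProd.const_mul _).mul this).ennreal_ofReal
  have hfac : (n.factorial : ENNReal) ≠ 0 := by exact_mod_cast n.factorial_ne_zero
  have hlaw := unorderedEigenvalueLaw_eq_withDensity hAm hA hDm
    (fun σ y => by rw [ensembleDensity_comp_perm]) h
  obtain ⟨C, hC⟩ : ∃ C, C = (n.factorial : ENNReal)⁻¹ * c := ⟨_, rfl⟩
  have hCtop : C ≠ ⊤ := hC ▸ ENNReal.mul_ne_top (ENNReal.inv_ne_top.mpr hfac) hc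
  rw [← hC] at hlaw
  -- The constant is positive and finite because the total mass is one.
  have hmass : ∫⁻ y, C * ENNReal.ofReal (ensembleDensity g Z y) = 1 := by
    rw [← setLIntegral_univ, ← withDensity_apply _ MeasurableSet.univ, ← hlaw,
      ← lintegral_one, lintegral_unorderedEigenvalueLaw μ hAm _ measurable_const]
    simp only [lintegral_one, measure_univ, Finset.sum_const, Finset.card_univ,
      Fintype.card_perm, Fintype.card_fin, nsmul_eq_mul, mul_one]
    exact ENNReal.inv_mul_cancel hfac (ENNReal.natCast_ne_top _)
  have hC0 : C ≠ 0 := by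
    rintro rfl
    simp at hmass
  have hCpos : 0 < C.toReal := ENNReal.toReal_pos hC0 hCtop
  have hscale : ∀ y, ensembleDensity g (Z / C.toReal) y = C.toReal * ensembleDensity g Z y := by
    intro y
    rw [ensembleDensity, ensembleDensity, one_div_div, div_eq_mul_one_div]
    ring
  have hscale' : ∀ y, ENNReal.ofReal (ensembleDensity g (Z / C.toReal) y)
      = C * ENNReal.ofReal (ensembleDensity g Z y) := by
    intro y
    rw [hscale, ENNReal.ofReal_mul hCpos.le, ENNReal.ofReal_toReal hCtop]
  refine ⟨Z / C.toReal, ⟨?_, hmom, div_ne_zero hZ hCpos.ne', ?_, ?_⟩, ?_⟩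
  · by_contra hli
    simp [ensembleDensity_eq_zero_of_not_linearIndependent hli] at hmass
  · refine ensembleDensity_nonneg_of_chamber fun y hy => ?_
    rw [hscale]
    exact mul_nonneg hCpos.le (hnn y hy)
  · simpa only [hscale'] using hmass
  · simpa only [hscale'] using hlaw

end PolyEns

theorem theorem3p2 {Ω : Type*} [MeasurableSpace Ω] (μ : Measure Ω) [IsProbabilityMeasure μ]
    (n : ℕ) (f : Fin (n + 1) → ℝ → ℝ)
    (X : Ω → Matrix (Fin (n + 1)) (Fin (n + 1)) ℂ) (hXmeas : Measurable X)
    (hX : ∀ ω, (X ω).IsHermitian)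
    (hXf : PolyEns.EigenvaluesArePolynomialEnsemble μ X hX f)
    (U : Ω → Matrix.unitaryGroup (Fin (n + 1)) ℂ) (hU : PolyEns.IsHaarUnitary μ U)
    (hXU : IndepFun X U μ) (i : Fin (n + 1)) :
    Nonempty (Module.Basis (Fin n) ℝ (PolyEns.zeroIntegralSpan f)) ∧
    ∀ ftilde : Module.Basis (Fin n) ℝ (PolyEns.zeroIntegralSpan f),
      PolyEns.EigenvaluesArePolynomialEnsemble μ
        (fun ω => PolyEns.restriction i (X ω) (U ω))
        (fun ω => PolyEns.isHermitian_restriction i (hX ω) (U ω))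
        (fun k y => ∫ x in Set.Iic y, (ftilde k : ℝ → ℝ) x) := by
  obtain ⟨Z, hens, hlaw⟩ := hXf
  have hf : ∀ k, Integrable (f k) := fun k => by simpa using hens.moments 0 k
  have hUm : Measurable U := hU.1
  have hcomp := (PolyEns.measurable_restriction i).comp (hXmeas.prodMk hUm)
  have hYm : Measurable fun ω => PolyEns.restriction i (X ω) (U ω) := hcomp
  have hsorted := fun (ψ : (Fin n → ℝ) → ENNReal) (hψ : Measurable ψ) =>
    PolyEns.lintegral_sortedEigenvalues_restriction_of_law hXmeas hX hf hens.nonneg hlaw hU hXU i hψ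
  -- If all integrals vanished, so would the total mass of the law of the compression.
  obtain ⟨m, hm⟩ : ∃ m, ∫ x, f m x ≠ 0 := by
    by_contra! h
    have h1 := hsorted 1 measurable_one
    simp [PolyEns.det_cumulativeMatrix_eq_zero h] at h1
  refine ⟨PolyEns.nonempty_basis_zeroIntegralSpan hens.linearIndependent hf hm, fun b => ?_⟩
  have hb := fun k => PolyEns.mem_zeroIntegralSpan.mp (b k).2
  obtain ⟨κ, hκ, hdet⟩ := PolyEns.exists_det_cumulativeMatrix_eq hf hm b
  have hcum : ∀ y, PolyEns.vandermondeProd y * (1 / Z * (PolyEns.cumulativeMatrix f y).det)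
      = PolyEns.ensembleDensity (fun k y => ∫ x in Set.Iic y, (b k : ℝ → ℝ) x) (Z / κ) y := by
    intro y
    rw [hdet y, PolyEns.ensembleDensity, one_div_div]
    ring
  simp only [hcum] at hsorted
  refine PolyEns.eigenvaluesArePolynomialEnsemble_of_sorted hYm _
    (fun k => (PolyEns.continuous_setIntegral_Iic (hb k).2.1).measurable) (fun j k => ?_)
    (div_ne_zero hens.norm_ne_zero hκ) (fun y hy => ?_)
    (ENNReal.mul_ne_top (ENNReal.natCast_ne_top _) (PolyEns.cornerConst_ne_top n)) hsorted
  · refine PolyEns.integrable_pow_mul_setIntegral_Iic (hb k).2.1 (hb k).2.2 ?_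
    exact PolyEns.integrable_pow_mul_of_mem_span (fun l => by simpa using hens.moments j.succ l)
      (hb k).1
  · rw [← hcum]
    exact mul_nonneg (PolyEns.vandermondeProd_pos hy).le
      (PolyEns.cumulativeMatrix_det_nonneg hf hens.nonneg hy.monotone)
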